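/- **Setting.** Graphs are finite simple mixed graphs: two distinct vertices are joined by at most one edge, of type $a - b$, $a\to b$ or $a\leftrightarrow b$, and there are no loops. If $a\to b$, $a$ is a parent of $b$ ($a\in\mathrm{pa}(b)$); if $a\leftrightarrow b$, $a$ is a spouse of $b$ ($a\in\mathrm{sp}(b)$). A path is a sequence of distinct vertices, consecutive ones being adjacent; a triple is a path on three vertices. A vertex $a$ is an ancestor of $b$ if $a=b$ or there is a directed path from $a$ to $b$. A graph is *ancestral* if (a) it has no directed cycle, (b) $x\leftrightarrow y$ implies that neither of $x,y$ is an ancestor of the other, and (c) $x - y$ implies that $x$ and $y$ have no parents and no spouses. A triple $\langle a,b,c\rangle$ is a *collider* if the edges $\langle a,b\rangle$ and $\langle c,b\rangle$ both have an arrowhead at $b$. A path between distinct $a,b\notin Z$ *m-connects* them given $Z$ if no noncollider on it is in $Z$ and every collider on it is an ancestor of a member of $Z$; disjoint sets $A,B$ are *m-separated* given $Z$ (disjoint from both) if no path m-connects some $a\in A$ and some $b\in B$ given $Z$. A *MAG* is an ancestral graph in which every two distinct nonadjacent vertices are m-separated by some $Z$ containing neither. Two MAGs on the same vertex set are *Markov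 equivalent*, $\mathcal G_1\sim\mathcal G_2$, if they have the same m-separations ($A$, $B$ nonempty). A path $\langle x,q_1,\dots,q_p,b,y\rangle$, $p\ge1$, is *discriminating* for $\langle q_p,b,y\rangle$ if $x,y$ are not adjacent and every $q_i$ is a collider on the path and a parent of $y$. Triples $\langle a,b,c\rangle$ with $a,c$ not adjacent have order $0$; a triple has order $i+1$ if it has no order $\le i$ and it or its reversal is discriminated by a path all of whose triples $\langle x,q_1,q_2\rangle,\dots,\langle q_{p-1},q_p,b\rangle$ have order $\le i$. Let $\mathfrak{Adj}(\mathcal G)$ be the set of ordered pairs of adjacent vertices, $\mathfrak{Col}(\mathcal G)$ the set of colliders, $\mathfrak{OCol}(\mathcal G)$ the set of colliders that have some order, and $\mathfrak{ICol}(\mathcal G)=\bigcap_{\mathcal G^*\sim\mathcal G}\mathfrak{Col}(\mathcal G^*)$, where $\mathcal G^*$ ranges over MAGs. **Algorithms.** $\mathbf{Triples}(\mathcal G)$: put $\mathbb T_0=\{\langle a,b,c\rangle\in\mathfrak{Col}(\mathcal G): a,c\text{ not adjacent}\}$. For $k=1,2,\dots$ let $\mathbb T_k$ be $\mathbb T_{k-1}$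 together with $\langle a,b,c\rangle$ and $\langle c,b,a\rangle$ for every $\langle a,b,c\rangle\in\mathfrak{Col}(\mathcal G)\setminus\mathbb T_{k-1}$ with $a\in\mathrm{sp}(b)\cap\mathrm{pa}(c)$ that passes the following test: let $\mathbb V=\{\langle t,u\rangle: t,u\in\mathrm{pa}(c),\ t\leftrightarrow u\}\cup\{\langle b,a\rangle\}$, let $\mathbb E=\{(\langle t,u\rangle,\langle u,v\rangle): \langle t,u,v\rangle\in\mathbb T_{k-1},\ \langle t,u\rangle,\langle u,v\rangle\in\mathbb V\}$, and let $\mathbb S$ be the set of elements reachable from $\langle b,a\rangle$ in the directed graph $(\mathbb V,\mathbb E)$, computed by breadth-first search; the test is that some $x$ not adjacent to $c$ satisfies $\langle z,y,x\rangle\in\mathbb T_{k-1}$ for some $\langle z,y\rangle\in\mathbb S$. Stop as soon as $\mathbb T_k=\mathbb T_{k-1}$, and return $\mathbb T_k$. $\mathbf{Equivalent}(\mathcal G_1,\mathcal G_2)$: return FALSE if $\mathfrak{Adj}(\mathcal G_1)\ne\mathfrak{Adj}(\mathcal G_2)$, or if $\mathbf{Triples}(\mathcal G_1)\not\subseteq\mathfrak{Col}(\mathcal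 G_2)$, or if $\mathbf{Triples}(\mathcal G_2)\not\subseteq\mathfrak{Col}(\mathcal G_1)$; otherwise return TRUE. Graphs are given as lists of their edges with the marks at both ends, and time is the number of steps on a random access machine with unit costs and initially blank memory, the words of which hold vertices and pointers. **Statement.** There is a constant $C$ such that the following hold. 1. For every MAG $\mathcal G$ with $n$ vertices and $e$ edges, $\mathbf{Triples}(\mathcal G)$ terminates after at most $C(n e^4+1)$ steps and returns a set $\mathbb T$ with $\mathfrak{OCol}(\mathcal G)\subseteq\mathbb T\subseteq\mathfrak{ICol}(\mathcal G)$. 2. For all MAGs $\mathcal G_1,\mathcal G_2$ on the same set of $n$ vertices, each with at most $e$ edges, $\mathbf{Equivalent}(\mathcal G_1,\mathcal G_2)$ terminates after at most $C(n e^4+1)$ steps, and it returns TRUE if and only if $\mathcal G_1$ and $\mathcal G_2$ are Markov equivalent. -/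

import Mathlib

/-! ## Mixed graphs -/

/-- The mark at one end of an edge. -/
inductive Mark where
  | tail
  | arrow
deriving DecidableEq

/-- A simple mixed graph on `V`: at most one edge between two vertices, no loops. `mark a b` is
the mark *at `b`* of the edge between `a` and `b`, and `none` if `a` and `b` are not adjacent. -/
structure MixedGraph (V : Type) where
  mark : V → V → Option Mark
  symm : ∀ a b, (mark a b).isSome → (mark b a).isSome
  irrefl : ∀ a, mark a a = none

namespace MixedGraph

variable {V : Type} (G : MixedGraph V)

/-- `a` and `b` are joined by some edge. -/
def Adj (a b : V) : Prop := (G.mark a b).isSome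

/-- There is an edge between `a` and `b` with an arrowhead at `b`. -/
def ArrowAt (a b : V) : Prop := G.mark a b = some Mark.arrow

/-- The undirected edge `a — b` (`a` is a neighbor of `b`). -/
def Undirected (a b : V) : Prop := G.mark a b = some Mark.tail ∧ G.mark b a = some Mark.tail

/-- The directed edge `a → b` (`a` is a parent of `b`). -/
def Directed (a b : V) : Prop := G.mark a b = some Mark.arrow ∧ G.mark b a = some Mark.tail

/-- The bi-directed edge `a ↔ b` (`a` is a spouse of `b`). -/
def Bidirected (a b : V) : Prop := G.mark a b = some Mark.arrow ∧ G.mark b a = some Mark.arrow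

/-- The simple graph formed by the adjacencies. -/
def skeleton : SimpleGraph V where
  Adj := G.Adj
  symm := ⟨fun a b h => G.symm a b h⟩
  loopless := ⟨fun a h => by simp [Adj, G.irrefl a] at h⟩

/-- The number of edges. -/
noncomputable def numEdges : ℕ := G.skeleton.edgeSet.ncard

/-- `a` is an ancestor of `b`: `a = b`, or there is a directed path from `a` to `b`. -/
def Ancestor (a b : V) : Prop := Relation.ReflTransGen G.Directed a b

/-- Ancestral graphs. -/
structure IsAncestral : Prop where
  /-- there are no directed cycles -/
  no_directed_cycle : ∀ a b, G.Directed a b → ¬ G.Ancestor b a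
  /-- a bi-directed edge never joins a vertex to one of its ancestors -/
  bidirected : ∀ a b, G.Bidirected a b → ¬ G.Ancestor a b ∧ ¬ G.Ancestor b a
  /-- the endpoints of an undirected edge have no spouses and no parents -/
  undirected : ∀ a b, G.Undirected a b →
    ∀ c, ¬ G.Bidirected c a ∧ ¬ G.Directed c a ∧ ¬ G.Bidirected c b ∧ ¬ G.Directed c b

/-- A path: a sequence of distinct vertices, consecutive ones being adjacent. -/
def IsPath (π : List V) : Prop := π.Nodup ∧ π.IsChain G.Adj

/-- `⟨a, b, c⟩` is a triple, i.e. a path on three vertices. -/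
def IsTriple (a b c : V) : Prop := G.IsPath [a, b, c]

/-- `⟨a, b, c⟩` is a triple on which two arrowheads meet at `b`. -/
def Collider (a b c : V) : Prop := a ≠ c ∧ G.ArrowAt a b ∧ G.ArrowAt c b

/-- The path `π` between `a` and `b` is m-connecting given `Z`: no noncollider on `π` is in `Z`
and every collider on `π` is an ancestor of a vertex in `Z`. -/
def MConnecting (a b : V) (Z : Set V) (π : List V) : Prop :=
  G.IsPath π ∧ π.head? = some a ∧ π.getLast? = some b ∧
    ∀ u v w, [u, v, w] <:+: π →
      (¬ G.Collider u v w → v ∉ Z) ∧ (G.Collider u v w → ∃ z ∈ Z, G.Ancestor v z)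

/-- `a` and `b` are m-separated given `Z`. -/
def MSep (a b : V) (Z : Set V) : Prop := ¬ ∃ π, G.MConnecting a b Z π

/-- The sets `A` and `B` are m-separated given `Z`. -/
def SetMSep (A B Z : Set V) : Prop := ∀ a ∈ A, ∀ b ∈ B, G.MSep a b Z

/-- Maximal ancestral graphs (MAGs). -/
structure IsMAG : Prop where
  ancestral : G.IsAncestral
  maximal : ∀ a b, a ≠ b → ¬ G.Adj a b → ∃ Z : Set V, a ∉ Z ∧ b ∉ Z ∧ G.MSep a b Z

/-- Markov equivalence of two graphs with the same vertex set. -/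
def MarkovEquiv (G₁ G₂ : MixedGraph V) : Prop :=
  ∀ A B Z : Set V, A.Nonempty → B.Nonempty → Disjoint A B → Disjoint A Z → Disjoint B Z →
    (G₁.SetMSep A B Z ↔ G₂.SetMSep A B Z)

/-- With `q₁, …, q_{p-1}` the members of `qs` and `q_p = a`, the path
`⟨x, q₁, …, q_p, b, y⟩` is a discriminating path for `⟨q_p, b, y⟩`: `x` and `y` are not adjacent,
and every `qᵢ` is a collider on the path and a parent of `y`. -/
def IsDiscriminating (x : V) (qs : List V) (a b y : V) : Prop :=
  G.IsPath (x :: (qs ++ [a, b, y])) ∧ ¬ G.Adj x y ∧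
    (∀ u v w, [u, v, w] <:+: x :: (qs ++ [a, b]) → G.Collider u v w) ∧
    (∀ q ∈ qs ++ [a], G.Directed q y)

/-- `⟨a, b, y⟩` is discriminated by a path on which all triples
`⟨x, q₁, q₂⟩, …, ⟨q_{p-1}, q_p, b⟩` belong to `D`. -/
def DiscriminatedWithin (D : Set (V × V × V)) (a b y : V) : Prop :=
  ∃ x qs, G.IsDiscriminating x qs a b y ∧
    ∀ u v w, [u, v, w] <:+: x :: (qs ++ [a, b]) → (u, v, w) ∈ D

/-- The triples of order at most `i`. -/
def orderAtMost : ℕ → Set (V × V × V)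
  | 0 => {τ | G.IsTriple τ.1 τ.2.1 τ.2.2 ∧ ¬ G.Adj τ.1 τ.2.2}
  | i + 1 => orderAtMost i ∪
      {τ | G.DiscriminatedWithin (orderAtMost i) τ.1 τ.2.1 τ.2.2 ∨
        G.DiscriminatedWithin (orderAtMost i) τ.2.2 τ.2.1 τ.1}

/-- The triples of order `i`: those of order at most `i` that do not have a smaller order. -/
def ofOrder : ℕ → Set (V × V × V)
  | 0 => G.orderAtMost 0
  | i + 1 => G.orderAtMost (i + 1) \ G.orderAtMost i

/-- The set of colliders of `G`. -/
def colliders : Set (V × V × V) := {τ | G.Collider τ.1 τ.2.1 τ.2.2}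

/-- The set of colliders with order of `G`. -/
def orderedColliders : Set (V × V × V) := {τ | τ ∈ G.colliders ∧ ∃ i, τ ∈ G.ofOrder i}

/-- The set of colliders common to all MAGs in the Markov equivalence class of `G`. -/
def invariantColliders : Set (V × V × V) :=
  {τ | ∀ H : MixedGraph V, H.IsMAG → MarkovEquiv H G → τ ∈ H.colliders}

/-- `L` is an edge list of `G`: it lists, without repetition, the two ends of every edge, the end
at `b` of an edge between `a` and `b` being written `(a, b, m)` with `m` the mark at `b`. -/
def ListedBy (L : List (V × V × Mark)) : Prop :=
  L.Nodup ∧ ∀ a b m, (a, b, m) ∈ L ↔ G.mark a b = some m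

end MixedGraph

/-! ## Computations with a step count

The cost model is the usual random access machine with unit costs, whose words hold vertices and
pointers and whose memory is initially blank. One step is charged for each of the following:
evaluating an expression made of boundedly many comparisons of vertices or marks and Boolean
connectives, testing whether a list is empty, putting an element in front of a list, advancing to
the next element of a list in a loop, reading or writing an entry of a table (an array indexed by
vertices, pairs of vertices, ...), and reserving a blank table. -/

/-- A computation, which need not terminate: if it does, the value is its result together with
the number of steps made. -/
structure Comp (α : Type) : Type where
  run : Part (α × ℕ)

namespace Comp

/-- The computation `x` terminates with the result `a` after exactly `t` steps. -/
def HaltsWith {α : Type} (x : Comp α) (a : α) (t : ℕ) : Prop :=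
  (a, t) ∈ x.run

instance : Monad Comp where
  pure a := ⟨Part.some (a, 0)⟩
  bind x f := ⟨x.run.bind fun p => (f p.1).run.map fun q => (q.1, p.2 + q.2)⟩

/-- One elementary step with result `a`. -/
def step {α : Type} (a : α) : Comp α := ⟨Part.some (a, 1)⟩

/-- The loop `for each x in l`, acting on a state; one step per element, besides the body. -/
def forEach {α σ : Type} : List α → σ → (σ → α → Comp σ) → Comp σ
  | [], s, _ => pure s
  | x :: l, s, body => do
      let x ← step x
      let s ← body s x
      forEach l s body

/-- One execution of the body of a `repeat` loop, on a state together with the number of steps made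
so far: the left summand leaves the loop, the right one continues it. -/
def iteration {σ : Type} (body : σ → Comp (σ × Bool)) : σ × ℕ →. (σ × ℕ) ⊕ (σ × ℕ) :=
  fun p => (body p.1).run.map fun q =>
    if q.1.2 then Sum.inl (q.1.1, p.2 + q.2) else Sum.inr (q.1.1, p.2 + q.2)

/-- The loop `repeat body until done`; the body returns the new state and the value of the
condition `done`. -/
def repeatUntil {σ : Type} (body : σ → Comp (σ × Bool)) (s : σ) : Comp σ :=
  ⟨(iteration body).fix (s, 0)⟩

end Comp

/-- A table, i.e. an array with entries in `α` indexed by `κ`. -/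
abbrev Table (κ α : Type) : Type := κ → α

namespace Table

variable {κ α : Type}

/-- Reserve a table all of whose entries have the value `a`, which stands for a blank entry. -/
def new (a : α) : Comp (Table κ α) := Comp.step fun _ => a

/-- Read the entry at `k`. -/
def read (T : Table κ α) (k : κ) : Comp α := Comp.step (T k)

/-- Write `a` in the entry at `k`. -/
def write [DecidableEq κ] (T : Table κ α) (k : κ) (a : α) : Comp (Table κ α) :=
  Comp.step (Function.update T k a)

end Table

/-! ## The algorithms -/

namespace Algorithm

open Comp

/-- The algorithm `Reachable(D, w)`. The directed graph `D` is given by a table `out` with the list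
of the elements `w₂` such that `⟨w₁, w₂⟩` is an edge, for each `w₁`. The set `S_p` is kept as a
table of flags together with the list `front` of the elements of `S_p \ S_{p-1}`; the condition
`S_p = S_{p-1}` holds when this list is empty. -/
def reachable {W : Type} [DecidableEq W] (out : Table W (List W)) (w : W) :
    Comp (Table W Bool) := do
  let s ← Table.new false
  let s ← Table.write s w true
  let front ← step [w]
  let r ← repeatUntil (fun p : Table W Bool × List W => do
    let q ← forEach p.2 (p.1, ([] : List W)) fun q w₁ => do
      let l ← Table.read out w₁
      forEach l q fun q w₂ => do
        if ← Table.read q.1 w₂ then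
          pure q
        else
          let s ← Table.write q.1 w₂ true
          let next ← step (w₂ :: q.2)
          pure (s, next)
    let done ← step q.2.isEmpty
    pure (q, done)) (s, front)
  pure r.1

variable {V : Type} [DecidableEq V]

/-- Set up the table of the marks from the edge list. -/
def load (L : List (V × V × Mark)) : Comp (Table (V × V) (Option Mark)) := do
  let g ← Table.new none
  forEach L g fun g p => Table.write g (p.1, p.2.1) (some p.2.2)

/-- Are `a` and `b` adjacent? -/
def testAdj (g : Table (V × V) (Option Mark)) (a b : V) : Comp Bool := do
  let m ← Table.read g (a, b)
  step m.isSome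

/-- Is there an edge `a → b`? -/
def testParent (g : Table (V × V) (Option Mark)) (a b : V) : Comp Bool := do
  let m ← Table.read g (a, b)
  let m' ← Table.read g (b, a)
  step (decide (m = some Mark.arrow ∧ m' = some Mark.tail))

/-- Is there an edge `a ↔ b`? -/
def testSpouse (g : Table (V × V) (Option Mark)) (a b : V) : Comp Bool := do
  let m ← Table.read g (a, b)
  let m' ← Table.read g (b, a)
  step (decide (m = some Mark.arrow ∧ m' = some Mark.arrow))

/-- Is `⟨a, b, c⟩` a collider? -/
def testCollider (g : Table (V × V) (Option Mark)) (a b c : V) : Comp Bool := do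
  let m ← Table.read g (a, b)
  let m' ← Table.read g (c, b)
  step (decide (a ≠ c ∧ m = some Mark.arrow ∧ m' = some Mark.arrow))

/-- Is `τ` in the list `T`? -/
def testMem (τ : V × V × V) (T : List (V × V × V)) : Comp Bool :=
  forEach T false fun r τ' => step (r || decide (τ = τ'))

/-- List the colliders of the graph. -/
def listColliders (L : List (V × V × Mark)) : Comp (List (V × V × V)) :=
  forEach L [] fun col p =>
    forEach L col fun col q => do
      if ← step (decide (p.2.1 = q.2.1 ∧ p.1 ≠ q.1 ∧ p.2.2 = Mark.arrow ∧ q.2.2 = Mark.arrow)) then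
        step ((p.1, p.2.1, q.1) :: col)
      else
        pure col

/-- List the colliders `⟨a, b, c⟩` with `a` and `c` not adjacent. -/
def listUnshielded (g : Table (V × V) (Option Mark)) (col : List (V × V × V)) :
    Comp (List (V × V × V)) :=
  forEach col [] fun T τ => do
    if ← testAdj g τ.1 τ.2.2 then
      pure T
    else
      step (τ :: T)

/-- The vertex set `𝕍` of the graph `𝔻` in the algorithm `Triples`, as a table of flags: the pairs
`⟨t, u⟩` with `t ↔ u` and both `t` and `u` parents of `c`, and the pair `⟨b, a⟩`. -/
def searchVertices (L : List (V × V × Mark)) (g : Table (V × V) (Option Mark)) (a b c : V) :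
    Comp (Table (V × V) Bool) := do
  let vs ← Table.new false
  let vs ← forEach L vs fun vs p => do
    let h₁ ← testParent g p.1 c
    let h₂ ← testParent g p.2.1 c
    let h₃ ← testSpouse g p.1 p.2.1
    if h₁ && h₂ && h₃ then
      Table.write vs (p.1, p.2.1) true
    else
      pure vs
  Table.write vs (b, a) true

/-- The edge set `𝔼` of the graph `𝔻` in the algorithm `Triples`, as a table of adjacency lists:
the pairs `⟨⟨t, u⟩, ⟨u, v⟩⟩` of elements of `𝕍` with `⟨t, u, v⟩` in `T`. -/
def searchEdges (T : List (V × V × V)) (vs : Table (V × V) Bool) :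
    Comp (Table (V × V) (List (V × V))) := do
  let out ← Table.new []
  forEach T out fun out τ => do
    let h₁ ← Table.read vs (τ.1, τ.2.1)
    let h₂ ← Table.read vs (τ.2.1, τ.2.2)
    if h₁ && h₂ then
      let l ← Table.read out (τ.1, τ.2.1)
      let l ← step ((τ.2.1, τ.2.2) :: l)
      Table.write out (τ.1, τ.2.1) l
    else
      pure out

/-- The body of the inner loop of the algorithm `Triples`, for the collider `⟨a, b, c⟩` and
`T = 𝕋_{k-1}`: is there an `x`, not adjacent to `c`, such that `⟨z, y, x⟩ ∈ T` for some `⟨z, y⟩`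
that is reachable from `⟨b, a⟩`? -/
def search (L : List (V × V × Mark)) (g : Table (V × V) (Option Mark)) (T : List (V × V × V))
    (a b c : V) : Comp Bool := do
  let vs ← searchVertices L g a b c
  let out ← searchEdges T vs
  let s ← reachable out (b, a)
  let xs ← forEach T ([] : List V) fun xs τ => do
    if ← Table.read s (τ.1, τ.2.1) then
      step (τ.2.2 :: xs)
    else
      pure xs
  forEach xs false fun r x => do
    let h ← testAdj g x c
    step (r || !h)

/-- One round of the outer loop of the algorithm `Triples`: from `T = 𝕋_{k-1}` to `𝕋_k`. The second
component of the result is the truth value of `𝕋_k = 𝕋_{k-1}`; as only triples that are not in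
`𝕋_{k-1}` are treated, it is false as soon as a triple is added. -/
def round (L : List (V × V × Mark)) (g : Table (V × V) (Option Mark)) (col : List (V × V × V))
    (T : List (V × V × V)) : Comp (List (V × V × V) × Bool) :=
  forEach col (T, true) fun s τ => do
    let h₁ ← testSpouse g τ.1 τ.2.1
    let h₂ ← testParent g τ.1 τ.2.2
    if h₁ && h₂ then
      if ← testMem τ T then
        pure s
      else if ← search L g T τ.1 τ.2.1 τ.2.2 then
        let T' ← step (τ :: s.1)
        let T' ← step ((τ.2.2, τ.2.1, τ.1) :: T')
        pure (T', false)
      else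
        pure s
    else
      pure s

/-- The algorithm `Triples`, applied to the graph with edge list `L`. -/
def triples (L : List (V × V × Mark)) : Comp (List (V × V × V)) := do
  let g ← load L
  let col ← listColliders L
  let T ← listUnshielded g col
  repeatUntil (round L g col) T

/-- Is every adjacency of the edge list `L` an adjacency of the graph with the table `g`? -/
def testAdjacencies (L : List (V × V × Mark)) (g : Table (V × V) (Option Mark)) : Comp Bool :=
  forEach L true fun r p => do
    let h ← testAdj g p.1 p.2.1
    step (r && h)

/-- Is every triple in `T` a collider of the graph with the table `g`? -/
def testColliders (T : List (V × V × V)) (g : Table (V × V) (Option Mark)) : Comp Bool :=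
  forEach T true fun r τ => do
    let h ← testCollider g τ.1 τ.2.1 τ.2.2
    step (r && h)

/-- The algorithm `Equivalent`, applied to the graphs with edge lists `L₁` and `L₂`. -/
def equivalent (L₁ L₂ : List (V × V × Mark)) : Comp Bool := do
  let g₁ ← load L₁
  let g₂ ← load L₂
  let h₁ ← testAdjacencies L₁ g₂
  let h₂ ← testAdjacencies L₂ g₁
  if h₁ && h₂ then
    let T₁ ← triples L₁
    if ← testColliders T₁ g₂ then
      let T₂ ← triples L₂
      if ← testColliders T₂ g₁ then
        pure true
      else
        pure false
    else
      pure false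
  else
    pure false

end Algorithm

/-!
The mathematical core is that two MAGs `G` and `H` with the same adjacencies, in which the colliders
with order of each are colliders in the other, are Markov equivalent (`Agree.markovEquiv`).

Colliders with order are described by the inductive predicates `OrdCol` and `DiscWalk`, in which
discriminating paths are replaced by walks; this is the form in which the algorithm finds them. By
induction, `G` and `H` have the same colliders with order and the same discriminating walks
(`Agree.ordCol_and_discWalk`), so they also agree on discriminated noncolliders.

Instead of m-connecting paths the proof uses routes, i.e. walks whose noncolliders avoid `Z` and
whose colliders are ancestors of `Z` or of the ends `s` and `t`; such a route exists if and only if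
`s` and `t` are m-connected (`IsRoute.exists_reaches`, `Reaches.exists_mConnecting`). With this
relaxed condition a shortcut of a route can fail only at a collider in `Z` that becomes a
noncollider. Hence in a shortest route every triple is unshielded or discriminated along the route
(`IsShortestRoute.leftOpen_or_rightOpen`), and maximality excludes that two triples depend on each
other in this way (`IsShortestRoute.not_mutually_open`). So all colliders on the route have order,
and `G` and `H` agree on its triples. If, among the shortest routes, one is chosen whose colliders
are as close as possible to `Z ∪ {s, t}`, then shortest directed paths from its colliders to this
set are directed in `H`, too (`Agree.exists_route`), so that it is a route of `H`.

Conversely, colliders with order are invariant (`OrdCol.collider_of_markovEquiv`): a set that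
separates the start of a discriminating walk for `⟨a, b, c⟩` from `c` contains the interior of the
walk but not `b`, in every equivalent MAG.

The algorithm `Triples` computes exactly the colliders with order (`ensures_triples`). For the
running time let `k` be the number of colliders, and `K` the number of those for which a search is
performed. There are at most `K + 1` rounds, with at most `K` searches each, and a search is linear
in `k + e`. Here `k ≤ 2 e n`, and as the colliders that are searched for are triangles,
`K ^ 2 ≤ (2 e) ^ 3` by the Cauchy–Schwarz inequality (`card_triangles_sq_le`), which gives
`O(n e ^ 4)`.
-/

/-! ### Marks and ancestors in ancestral graphs -/

namespace MixedGraph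

variable {V : Type} {G H : MixedGraph V} {a b c s t u v w y z : V} {A B Z : Set V}

theorem Adj.symm (h : G.Adj a b) : G.Adj b a := G.symm a b h

theorem Adj.ne (h : G.Adj a b) : a ≠ b := by
  rintro rfl
  simp [Adj, G.irrefl] at h

theorem ArrowAt.adj (h : G.ArrowAt a b) : G.Adj a b := by
  simp only [ArrowAt] at h
  simp [Adj, h]

theorem Directed.arrowAt (h : G.Directed a b) : G.ArrowAt a b := h.1

theorem Directed.adj (h : G.Directed a b) : G.Adj a b := h.arrowAt.adj

theorem Directed.not_arrowAt (h : G.Directed a b) : ¬ G.ArrowAt b a := by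
  simp [ArrowAt, h.2]

theorem Adj.mark_eq_tail (h : G.Adj a b) (hn : ¬ G.ArrowAt a b) : G.mark a b = some Mark.tail := by
  obtain ⟨m, hm⟩ := Option.isSome_iff_exists.1 h
  cases m
  · exact hm
  · exact absurd hm hn

theorem Collider.symm (h : G.Collider a b c) : G.Collider c b a := ⟨h.1.symm, h.2.2, h.2.1⟩

/-- Conditions (a) and (b) in the definition of ancestral graphs taken together: no edge has an
arrowhead at an ancestor of its other end. -/
theorem IsAncestral.not_arrowAt (hG : G.IsAncestral) (h : G.Ancestor a b) :
    ¬ G.ArrowAt b a := by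
  intro hba
  by_cases hab : G.ArrowAt a b
  · exact (hG.bidirected a b ⟨hab, hba⟩).1 h
  · exact hG.no_directed_cycle b a ⟨hba, (hba.adj.symm).mark_eq_tail hab⟩ h

/-- By condition (c) in the definition of ancestral graphs, an edge with a tail at a vertex that
has some arrowhead is directed out of that vertex. -/
theorem IsAncestral.directed (hG : G.IsAncestral) (hu : G.ArrowAt u y) (hy : G.Adj y c)
    (hc : ¬ G.ArrowAt c y) : G.Directed y c := by
  have ht := hy.symm.mark_eq_tail hc
  refine ⟨?_, ht⟩
  by_contra hn
  have hund := hG.undirected y c ⟨hy.mark_eq_tail hn, ht⟩ u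
  by_cases huy : G.ArrowAt y u
  · exact hund.1 ⟨hu, huy⟩
  · exact hund.2.1 ⟨hu, hu.adj.symm.mark_eq_tail huy⟩

theorem IsAncestral.arrowAt_of_directed (hG : G.IsAncestral) (ha : G.ArrowAt a v)
    (hv : G.Directed v w) (haw : G.Adj a w) : G.ArrowAt a w := by
  by_contra hn
  have hwa := hG.directed hv.arrowAt haw.symm hn
  exact hG.not_arrowAt ((Relation.ReflTransGen.single hv).tail hwa) ha

theorem IsAncestral.directed_of_directed (hG : G.IsAncestral) (hu : G.Directed u v)
    (hv : G.Directed v w) (huw : G.Adj u w) : G.Directed u w := by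
  refine ⟨hG.arrowAt_of_directed hu.arrowAt hv huw, ?_⟩
  exact huw.symm.mark_eq_tail (hG.not_arrowAt ((Relation.ReflTransGen.single hu).tail hv))

/-- The set of the ancestors of the members of `B`. -/
def ancestors (G : MixedGraph V) (B : Set V) : Set V := {v | ∃ b ∈ B, G.Ancestor v b}

theorem subset_ancestors (hv : v ∈ B) : v ∈ G.ancestors B := ⟨v, hv, Relation.ReflTransGen.refl⟩

theorem Directed.mem_ancestors (h : G.Directed u v) (hv : v ∈ G.ancestors B) :
    u ∈ G.ancestors B := by
  obtain ⟨b, hb, hvb⟩ := hv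
  exact ⟨b, hb, hvb.head h⟩

/-! ### Routes -/

/-- The condition that a route satisfies at an internal vertex `b` with neighbors `a` and `c`:
`b` is in `A` if two arrowheads meet at `b`, and not in `Z` otherwise. The vertices `a` and `c`
may coincide. -/
def Passable (G : MixedGraph V) (A Z : Set V) (a b c : V) : Prop :=
  (G.ArrowAt a b ∧ G.ArrowAt c b → b ∈ A) ∧ (¬ (G.ArrowAt a b ∧ G.ArrowAt c b) → b ∉ Z)

/-- The sequence `x 0, …, x n` is a route between `s` and `t`, i.e. consecutive vertices are
adjacent, each collider on it is in `A`, and no noncollider on it is in `Z`. Vertices may be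
repeated. -/
structure IsRoute (G : MixedGraph V) (A Z : Set V) (s t : V) (n : ℕ) (x : ℕ → V) : Prop where
  first : x 0 = s
  last : x n = t
  adj : ∀ i < n, G.Adj (x i) (x (i + 1))
  pass : ∀ i, i + 1 < n → G.Passable A Z (x i) (x (i + 1)) (x (i + 2))

namespace IsRoute

variable {n : ℕ} {x : ℕ → V}

theorem pass_at (h : G.IsRoute A Z s t n x) {k : ℕ} (h0 : 0 < k) (hk : k < n) :
    G.Passable A Z (x (k - 1)) (x k) (x (k + 1)) := by
  obtain ⟨p, rfl⟩ := Nat.exists_eq_add_of_lt h0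
  simpa using h.pass p (by omega)

theorem single (v : V) : G.IsRoute A Z v v 0 (fun _ => v) :=
  ⟨rfl, rfl, by simp, by simp⟩

theorem take (h : G.IsRoute A Z s t n x) {i : ℕ} (hi : i ≤ n) : G.IsRoute A Z s (x i) i x :=
  ⟨h.first, rfl, fun m hm => h.adj m (by omega), fun m hm => h.pass m (by omega)⟩

theorem drop (h : G.IsRoute A Z s t n x) {j : ℕ} (hj : j ≤ n) :
    G.IsRoute A Z (x j) t (n - j) (fun m => x (j + m)) :=
  ⟨rfl, by simpa [Nat.add_sub_cancel' hj] using h.last, fun m hm => h.adj (j + m) (by omega),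
    fun m hm => h.pass (j + m) (by omega)⟩

/-- The route that follows `x` for `n` steps and continues with the route `y`. -/
theorem join (h : G.IsRoute A Z s b n x) {m : ℕ} {y : ℕ → V} (h' : G.IsRoute A Z c t m y)
    (hbc : G.Adj b c) (hb : 0 < n → G.Passable A Z (x (n - 1)) b c)
    (hc : 0 < m → G.Passable A Z b c (y 1)) :
    G.IsRoute A Z s t (n + 1 + m) (fun i => if i ≤ n then x i else y (i - (n + 1))) := by
  refine ⟨by simp [h.first], by simp [show ¬ (n + 1 + m ≤ n) by omega, h'.last], ?_, ?_⟩
  · intro i hi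
    rcases lt_trichotomy i n with hin | rfl | hin
    · simpa [hin.le, Nat.succ_le_of_lt hin] using h.adj i hin
    · simpa [h.last, h'.first] using hbc
    · obtain ⟨d, rfl⟩ := Nat.exists_eq_add_of_lt hin
      have := h'.adj d (by omega)
      simpa [show ¬ (n + d + 1 ≤ n) by omega, show ¬ (n + d + 1 + 1 ≤ n) by omega,
        show n + d + 1 - (n + 1) = d by omega, show n + d + 1 + 1 - (n + 1) = d + 1 by omega]
        using this
  · intro i hi
    rcases lt_trichotomy (i + 1) n with hin | hin | hin
    · simpa [hin.le, show i ≤ n by omega, show i + 2 ≤ n by omega] using h.pass i hin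
    · subst hin
      simpa [h.last, h'.first] using hb (by omega)
    · rcases Nat.eq_or_lt_of_le (show n ≤ i by omega) with rfl | hin'
      · have := hc (by omega)
        simpa [h.last, h'.first, show n + 2 - (n + 1) = 1 by omega] using this
      · obtain ⟨d, rfl⟩ := Nat.exists_eq_add_of_lt hin'
        have := h'.pass d (by omega)
        simpa [show ¬ (n + d + 1 ≤ n) by omega, show ¬ (n + d + 1 + 1 ≤ n) by omega,
          show ¬ (n + d + 1 + 2 ≤ n) by omega,
          show n + d + 1 - (n + 1) = d by omega, show n + d + 1 + 1 - (n + 1) = d + 1 by omega,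
          show n + d + 1 + 2 - (n + 1) = d + 2 by omega] using this

/-- A route that leaves a vertex with an arrowhead through a tail at that vertex is directed as
far as the next collider, if there is one. -/
theorem tail_forward (h : G.IsRoute A Z s t n x) (hG : G.IsAncestral)
    (hA : ∀ u v, G.Directed u v → v ∈ A → u ∈ A) :
    ∀ (d i : ℕ), i + d + 1 ≤ n → (∃ u, G.ArrowAt u (x i)) → ¬ G.ArrowAt (x (i + 1)) (x i) →
      x i ∈ A ∨ Relation.TransGen G.Directed (x i) (x (i + d + 1)) := by
  intro d
  induction d with
  | zero =>
    rintro i hi ⟨u, hu⟩ ht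
    exact Or.inr (.single (hG.directed hu (h.adj i (by omega)) ht))
  | succ d ih =>
    rintro i hi ⟨u, hu⟩ ht
    have hd := hG.directed hu (h.adj i (by omega)) ht
    by_cases hc : G.ArrowAt (x (i + 2)) (x (i + 1))
    · exact Or.inl (hA _ _ hd ((h.pass i (by omega)).1 ⟨hd.arrowAt, hc⟩))
    · rcases ih (i + 1) (by omega) ⟨_, hd.arrowAt⟩ hc with h' | h'
      · exact Or.inl (hA _ _ hd h')
      · rw [show i + (d + 1) + 1 = i + 1 + d + 1 by omega]
        exact Or.inr (.head hd h')

theorem tail_backward (h : G.IsRoute A Z s t n x) (hG : G.IsAncestral)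
    (hA : ∀ u v, G.Directed u v → v ∈ A → u ∈ A) :
    ∀ i, i + 1 ≤ n → (∃ u, G.ArrowAt u (x (i + 1))) → ¬ G.ArrowAt (x i) (x (i + 1)) →
      x (i + 1) ∈ A ∨ Relation.TransGen G.Directed (x (i + 1)) (x 0) := by
  intro i
  induction i with
  | zero =>
    rintro hi ⟨u, hu⟩ ht
    exact Or.inr (.single (hG.directed hu (h.adj 0 (by omega)).symm ht))
  | succ i ih =>
    rintro hi ⟨u, hu⟩ ht
    have hd := hG.directed hu (h.adj (i + 1) (by omega)).symm ht
    by_cases hc : G.ArrowAt (x i) (x (i + 1))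
    · exact Or.inl (hA _ _ hd ((h.pass i (by omega)).1 ⟨hc, hd.arrowAt⟩))
    · rcases ih (by omega) ⟨_, hd.arrowAt⟩ hc with h' | h'
      · exact Or.inl (hA _ _ hd h')
      · exact Or.inr (.head hd h')

end IsRoute

/-- `x` is a route between `s` and `t` with as few vertices as possible. -/
structure IsShortestRoute (G : MixedGraph V) (A Z : Set V) (s t : V) (n : ℕ) (x : ℕ → V) : Prop
    extends G.IsRoute A Z s t n x where
  shortest : ∀ m y, G.IsRoute A Z s t m y → n ≤ m

theorem IsRoute.exists_shortest {n : ℕ} {x : ℕ → V} (h : G.IsRoute A Z s t n x) :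
    ∃ m y, G.IsShortestRoute A Z s t m y := by
  classical
  have hex : ∃ m, ∃ y, G.IsRoute A Z s t m y := ⟨n, x, h⟩
  obtain ⟨y, hy⟩ := Nat.find_spec hex
  exact ⟨_, y, hy, fun m z hz => Nat.find_min' hex ⟨z, hz⟩⟩

namespace IsShortestRoute

variable {n : ℕ} {x : ℕ → V}

/-- On a shortest route, an edge between `x i` and `x j` is not a shortcut. -/
theorem not_shortcut (h : G.IsShortestRoute A Z s t n x) {i j : ℕ} (hij : i + 1 < j) (hj : j ≤ n)
    (hadj : G.Adj (x i) (x j)) (hi : 0 < i → G.Passable A Z (x (i - 1)) (x i) (x j))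
    (hj' : j < n → G.Passable A Z (x i) (x j) (x (j + 1))) : False := by
  have := h.shortest _ _ ((h.take (i := i) (by omega)).join (h.drop hj) hadj hi
    (fun hp => hj' (by omega)))
  omega

/-- A shortest route is a path. At a repeated vertex the part between two visits can be left
out: if the vertex becomes a collider without having been one before, then by `tail_forward` it
is in `A` or on a directed cycle. -/
theorem injective (h : G.IsShortestRoute A Z s t n x) (hG : G.IsAncestral)
    (hA : ∀ u v, G.Directed u v → v ∈ A → u ∈ A) {i j : ℕ} (hij : i < j) (hj : j ≤ n) :
    x i ≠ x j := by
  intro heq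
  rcases Nat.eq_or_lt_of_le hj with rfl | hjn
  · have h1 := h.take hij.le
    rw [heq, h.last] at h1
    have := h.shortest _ _ h1
    omega
  · refine h.not_shortcut (i := i) (j := j + 1) (by omega) (by omega) (heq ▸ h.adj j hjn) ?_ ?_
    · intro hi
      have p1 := h.pass_at hi (by omega)
      have p2 := h.pass_at (by omega : 0 < j) hjn
      refine ⟨fun hc => ?_, fun hc hz => ?_⟩
      · by_cases h1 : G.ArrowAt (x (i + 1)) (x i)
        · exact p1.1 ⟨hc.1, h1⟩
        · obtain ⟨d, rfl⟩ := Nat.exists_eq_add_of_lt hij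
          rcases h.tail_forward hG hA d i (by omega) ⟨_, hc.1⟩ h1 with h2 | h2
          · exact h2
          · rw [← heq] at h2
            obtain ⟨e, he, hee⟩ := Relation.TransGen.head'_iff.1 h2
            exact absurd hee (hG.no_directed_cycle _ _ he)
      · by_cases h1 : G.ArrowAt (x (i - 1)) (x i)
        · exact p2.2 (fun h3 => hc ⟨h1, heq ▸ h3.2⟩) (heq ▸ hz)
        · exact p1.2 (fun h3 => h1 h3.1) hz
    · intro hj1
      rw [heq]
      exact h.pass j hj1

end IsShortestRoute

end MixedGraph

/-! ### Routes and m-connecting paths -/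

namespace MixedGraph

variable {V : Type} {G H : MixedGraph V} {a b c s t u v w y z : V} {A B Z : Set V}

/-- `G.Reaches s Z v m`: some route from `s` with at least one edge, on which every collider is an
ancestor of a member of `Z` and no noncollider is in `Z`, ends in `v` with an edge that has the
mark `m` at `v`. -/
inductive Reaches (G : MixedGraph V) (s : V) (Z : Set V) : V → Mark → Prop
  | start {v m} : G.mark s v = some m → Reaches G s Z v m
  | step {v w m m'} : Reaches G s Z v m → G.mark v w = some m' →
      (m = Mark.arrow ∧ G.ArrowAt w v → v ∈ G.ancestors Z) →
      (¬ (m = Mark.arrow ∧ G.ArrowAt w v) → v ∉ Z) → Reaches G s Z w m'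

theorem Reaches.step_tail {m m' : Mark} (h : G.Reaches s Z v m) (hw : G.mark v w = some m')
    (ht : ¬ G.ArrowAt w v) (hv : v ∉ Z) : G.Reaches s Z w m' :=
  h.step hw (fun h' => absurd h'.2 ht) fun _ => hv

theorem Reaches.exists_route {m : Mark} (h : G.Reaches s Z v m) :
    ∃ n x, G.IsRoute (G.ancestors Z) Z s v (n + 1) x ∧ G.mark (x n) v = some m := by
  induction h with
  | @start v m h =>
    refine ⟨0, fun i => if i ≤ 0 then s else v, ?_, by simpa using h⟩
    exact (IsRoute.single s).join (IsRoute.single v) (by simp [Adj, h]) (by simp) (by simp)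
  | @step v w m m' _ hw h1 h2 ih =>
    obtain ⟨n, x, hx, hm⟩ := ih
    refine ⟨n + 1, fun i => if i ≤ n + 1 then x i else w, ?_, by simpa [hx.last] using hw⟩
    refine hx.join (IsRoute.single w) (by simp [Adj, hw]) (fun _ => ?_) (by simp)
    have harr : G.ArrowAt (x n) v ↔ m = Mark.arrow := by simp [ArrowAt, hm]
    simp only [Passable, Nat.add_sub_cancel, harr]
    exact ⟨h1, h2⟩

theorem Reaches.of_ancestor_start (h : G.Ancestor v s) (hv : v ∉ G.ancestors Z) :
    v = s ∨ G.Reaches s Z v Mark.tail := by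
  induction h using Relation.ReflTransGen.head_induction_on with
  | refl => exact Or.inl rfl
  | @head v w hvw _ ih =>
    right
    have hw : w ∉ G.ancestors Z := fun hw => hv (hvw.mem_ancestors hw)
    rcases ih hw with rfl | hr
    · exact .start hvw.2
    · exact hr.step hvw.2 (by simp) fun _ hz => hw (subset_ancestors hz)

theorem Reaches.of_ancestor_end {m : Mark} (hr : G.Reaches s Z v m) (h : G.Ancestor v t)
    (hv : v ∉ G.ancestors Z) : ∃ m, G.Reaches s Z t m := by
  induction h using Relation.ReflTransGen.head_induction_on generalizing m with
  | refl => exact ⟨m, hr⟩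
  | @head v w hvw _ ih =>
    exact ih (hr.step_tail hvw.1 hvw.not_arrowAt fun hz => hv (subset_ancestors hz))
      fun hw => hv (hvw.mem_ancestors hw)

/-- Colliders that are ancestors of the ends of a route can be tolerated: a directed path from
such a collider to an end can replace the corresponding part of the route. -/
theorem IsRoute.exists_reaches {n : ℕ} {x : ℕ → V}
    (h : G.IsRoute (G.ancestors (insert s (insert t Z))) Z s t n x) (hst : s ≠ t) :
    ∃ m, G.Reaches s Z t m := by
  have key : ∀ k, k < n → (∃ m, G.Reaches s Z t m) ∨
      ∃ m, G.mark (x k) (x (k + 1)) = some m ∧ G.Reaches s Z (x (k + 1)) m := by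
    intro k
    induction k with
    | zero =>
      intro hk
      obtain ⟨m, hm⟩ := Option.isSome_iff_exists.1 (h.adj 0 hk)
      exact Or.inr ⟨m, hm, .start (h.first ▸ hm)⟩
    | succ k ih =>
      intro hk
      rcases ih (by omega) with h' | ⟨m, hm, hr⟩
      · exact Or.inl h'
      obtain ⟨m', hm'⟩ := Option.isSome_iff_exists.1 (h.adj (k + 1) hk)
      have hp := h.pass k hk
      have harr : G.ArrowAt (x k) (x (k + 1)) ↔ m = Mark.arrow := by simp [ArrowAt, hm]
      rw [Passable, harr] at hp
      by_cases hc : m = Mark.arrow ∧ G.ArrowAt (x (k + 2)) (x (k + 1))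
      · by_cases hz : x (k + 1) ∈ G.ancestors Z
        · exact Or.inr ⟨m', hm', hr.step hm' (fun _ => hz) fun h' => absurd hc h'⟩
        obtain ⟨b, hb, hanc⟩ := hp.1 hc
        rcases hb with rfl | rfl | hb
        · rcases Reaches.of_ancestor_start hanc hz with heq | hr'
          · exact Or.inr ⟨m', hm', .start (heq ▸ hm')⟩
          · exact Or.inr ⟨m', hm', hr'.step hm' (by simp)
              fun _ hz' => hz (subset_ancestors hz')⟩
        · exact Or.inl (hr.of_ancestor_end hanc hz)
        · exact absurd ⟨b, hb, hanc⟩ hz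
      · exact Or.inr ⟨m', hm', hr.step hm' (fun h' => absurd h' hc) hp.2⟩
  have hn : n ≠ 0 := by
    rintro rfl
    exact hst (h.first.symm.trans h.last)
  rcases key (n - 1) (by omega) with h' | ⟨m, -, hr⟩
  · exact h'
  · rw [Nat.sub_add_cancel (by omega), h.last] at hr
    exact ⟨m, hr⟩

theorem IsShortestRoute.mConnecting {n : ℕ} {x : ℕ → V} (hG : G.IsAncestral)
    (h : G.IsShortestRoute (G.ancestors Z) Z s t n x) :
    G.MConnecting s t Z ((List.range (n + 1)).map x) := by
  have hinj : ∀ i j, i < j → j ≤ n → x i ≠ x j := fun i j hij hj =>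
    h.injective hG (fun _ _ => Directed.mem_ancestors) hij hj
  refine ⟨⟨?_, ?_⟩, ?_, ?_, ?_⟩
  · refine List.Nodup.map_on ?_ List.nodup_range
    intro i hi j hj hij
    simp only [List.mem_range] at hi hj
    rcases lt_trichotomy i j with h' | h' | h'
    · exact absurd hij (hinj i j h' (by omega))
    · exact h'
    · exact absurd hij.symm (hinj j i h' (by omega))
  · rw [List.isChain_map, List.isChain_iff_getElem]
    intro i hi
    simp only [List.length_range] at hi
    simpa using h.adj i (by omega)
  · simp [List.range_succ_eq_map, h.first]
  · simp [List.range_succ, h.last]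
  · rintro u v w ⟨l₁, l₂, hl⟩
    have key : ∀ k, (l₁ ++ [u, v, w] ++ l₂)[l₁.length + k]? = ([u, v, w] ++ l₂)[k]? := by
      intro k
      rw [List.append_assoc, List.getElem?_append_right (by omega)]
      simp
    have hlen : l₁.length + 2 ≤ n := by
      have := congrArg List.length hl
      simp at this
      omega
    rw [hl] at key
    have e0 := key 0
    have e1 := key 1
    have e2 := key 2
    rw [List.getElem?_map, List.getElem?_range (by omega)] at e0 e1 e2
    simp only [Option.map_some, Nat.add_zero, List.cons_append, List.getElem?_cons_zero,
      List.getElem?_cons_succ, Option.some.injEq] at e0 e1 e2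
    have hp := h.pass l₁.length (by omega)
    have hne := hinj l₁.length (l₁.length + 2) (by omega) hlen
    rw [e0, e1, e2] at hp
    rw [e0, e2] at hne
    exact ⟨fun hc => hp.2 fun h' => hc ⟨hne, h'⟩, fun hc => hp.1 hc.2⟩

theorem MConnecting.exists_route {π : List V} (h : G.MConnecting s t Z π) :
    ∃ n x, G.IsRoute (G.ancestors Z) Z s t n x := by
  obtain ⟨⟨hnd, hch⟩, hs, ht, hp⟩ := h
  have hne : π ≠ [] := by
    rintro rfl
    simp at hs
  have hpos : 0 < π.length := List.length_pos_iff.2 hne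
  refine ⟨π.length - 1, fun i => π.getD i s, ?_, ?_, ?_, ?_⟩
  · simp [List.getD_eq_getElem?_getD, ← List.head?_eq_getElem?, hs]
  · simp [List.getD_eq_getElem?_getD, ← List.getLast?_eq_getElem?, ht]
  · intro i hi
    rw [List.isChain_iff_getElem] at hch
    simp only [List.getD_eq_getElem _ _ (show i < π.length by omega),
      List.getD_eq_getElem _ _ (show i + 1 < π.length by omega)]
    exact hch i (by omega)
  · intro i hi
    have h0 : i < π.length := by omega
    have h1 : i + 1 < π.length := by omega
    have h2 : i + 2 < π.length := by omega
    simp only [List.getD_eq_getElem _ _ h0, List.getD_eq_getElem _ _ h1,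
      List.getD_eq_getElem _ _ h2]
    have hinf : [π[i], π[i + 1], π[i + 2]] <:+: π := by
      refine ⟨π.take i, π.drop (i + 3), ?_⟩
      rw [List.append_assoc]
      conv_rhs => rw [← List.take_append_drop i π, List.drop_eq_getElem_cons h0,
        List.drop_eq_getElem_cons h1, List.drop_eq_getElem_cons h2]
      rfl
    have hne : π[i] ≠ π[i + 2] := by
      intro he
      have := (hnd.getElem_inj_iff).1 he
      omega
    have := hp _ _ _ hinf
    exact ⟨fun hc => this.2 ⟨hne, hc⟩, fun hc => this.1 fun h' => hc h'.2⟩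

theorem Reaches.exists_mConnecting {m : Mark} (hG : G.IsAncestral) (h : G.Reaches s Z t m) :
    ∃ π, G.MConnecting s t Z π := by
  obtain ⟨n, x, hx, -⟩ := h.exists_route
  obtain ⟨k, y, hy⟩ := hx.exists_shortest
  exact ⟨_, hy.mConnecting hG⟩

theorem MSep.not_reaches {m : Mark} (hG : G.IsAncestral) (h : G.MSep s t Z) :
    ¬ G.Reaches s Z t m := fun hr => h (hr.exists_mConnecting hG)

theorem IsRoute.mono {n : ℕ} {x : ℕ → V} (h : G.IsRoute A Z s t n x) (hAB : A ⊆ B) :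
    G.IsRoute B Z s t n x :=
  ⟨h.first, h.last, h.adj, fun i hi => ⟨fun hc => hAB ((h.pass i hi).1 hc), (h.pass i hi).2⟩⟩

/-- The ends of an inducing path in a MAG are adjacent: if all internal vertices of a walk are
colliders and ancestors of its ends, then no set separates these. -/
theorem IsMAG.adj_of_inducing (hG : G.IsMAG) {n : ℕ} {x : ℕ → V}
    (hx : ∀ i < n, G.Adj (x i) (x (i + 1))) (hne : x 0 ≠ x n)
    (hcol : ∀ i, i + 1 < n → G.ArrowAt (x i) (x (i + 1)) ∧ G.ArrowAt (x (i + 2)) (x (i + 1)))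
    (hanc : ∀ i, i + 1 < n → G.Ancestor (x (i + 1)) (x 0) ∨ G.Ancestor (x (i + 1)) (x n)) :
    G.Adj (x 0) (x n) := by
  by_contra hadj
  obtain ⟨Z, -, -, hsep⟩ := hG.maximal _ _ hne hadj
  have hr : G.IsRoute (G.ancestors (insert (x 0) (insert (x n) Z))) Z (x 0) (x n) n x := by
    refine ⟨rfl, rfl, hx, fun i hi => ⟨fun _ => ?_, fun h => absurd (hcol i hi) h⟩⟩
    rcases hanc i hi with h | h
    · exact ⟨x 0, by simp, h⟩
    · exact ⟨x n, by simp, h⟩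
  obtain ⟨m, hm⟩ := hr.exists_reaches hne
  exact hsep.not_reaches hG.ancestral hm

end MixedGraph

/-! ### Colliders with order -/

namespace MixedGraph

variable {V : Type} {G H : MixedGraph V} {a b c s t u v w x y z : V} {A B Z : Set V}

mutual

/-- The smallest symmetric set of colliders that contains the unshielded ones, and every collider
`⟨a, b, c⟩` discriminated by a walk on which all triples before the last one belong to the set.
In contrast to the definition of triples with order, discriminating walks may repeat vertices,
as they can when found by a search. -/
inductive OrdCol (G : MixedGraph V) : V → V → V → Prop
  | unshielded {a b c : V} : G.Collider a b c → ¬ G.Adj a c → OrdCol G a b c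
  | discriminated {a b c : V} : G.Collider a b c → DiscWalk G c b a → OrdCol G a b c
  | symm {a b c : V} : OrdCol G a b c → OrdCol G c b a

/-- `DiscWalk G c z y`: there is a walk `z, y, q₁, …, qᵣ, x` on which all triples belong to
`OrdCol G`, such that `y, q₁, …, qᵣ` are parents of `c` and `x` is not adjacent to `c`. -/
inductive DiscWalk (G : MixedGraph V) : V → V → V → Prop
  | base {c z y x : V} : G.Directed y c → OrdCol G z y x → ¬ G.Adj x c → DiscWalk G c z y
  | step {c z y u : V} : G.Directed y c → OrdCol G z y u → DiscWalk G c y u → DiscWalk G c z y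

end

theorem OrdCol.collider (h : G.OrdCol a b c) : G.Collider a b c := by
  refine OrdCol.rec (motive_1 := fun a b c _ => G.Collider a b c) (motive_2 := fun _ _ _ _ => True)
    (fun h _ => h) (fun h _ _ => h) (fun _ h => h.symm) ?_ ?_ h
  · intros; trivial
  · intros; trivial

theorem DiscWalk.directed (h : G.DiscWalk c z y) : G.Directed y c := by
  cases h <;> assumption

theorem DiscWalk.exists_ordCol (h : G.DiscWalk c z y) : ∃ u, G.OrdCol z y u := by
  cases h
  · exact ⟨_, ‹_›⟩
  · exact ⟨_, ‹_›⟩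

/-- `⟨a, b, c⟩` is unshielded, or discriminated by a walk that ends with `a, b, c`. -/
def Certified (G : MixedGraph V) (a b c : V) : Prop := ¬ G.Adj a c ∨ G.DiscWalk c b a

theorem Certified.ordCol (h : G.Certified a b c) (hc : G.Collider a b c) : G.OrdCol a b c :=
  h.elim (.unshielded hc) (.discriminated hc)

/-! ### Markov equivalence and separation of single vertices -/

theorem setMSep_singleton : G.SetMSep {a} {b} Z ↔ G.MSep a b Z := by
  simp [SetMSep]

theorem MarkovEquiv.symm (h : MarkovEquiv G H) : MarkovEquiv H G :=
  fun A B Z hA hB h1 h2 h3 => (h A B Z hA hB h1 h2 h3).symm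

theorem MarkovEquiv.mSep_iff (h : MarkovEquiv G H) (hab : a ≠ b) (ha : a ∉ Z) (hb : b ∉ Z) :
    G.MSep a b Z ↔ H.MSep a b Z := by
  rw [← setMSep_singleton, ← setMSep_singleton]
  exact h {a} {b} Z (by simp) (by simp) (by simpa using hab) (by simpa using ha) (by simpa using hb)

theorem markovEquiv_of_mSep_iff
    (h : ∀ a b Z, a ≠ b → a ∉ Z → b ∉ Z → (G.MSep a b Z ↔ H.MSep a b Z)) : MarkovEquiv G H := by
  intro A B Z _ _ hAB hAZ hBZ
  have key : ∀ a ∈ A, ∀ b ∈ B, (G.MSep a b Z ↔ H.MSep a b Z) := fun a ha b hb =>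
    h a b Z (fun he => hAB.ne_of_mem ha hb he) (hAZ.notMem_of_mem_left ha)
      (hBZ.notMem_of_mem_left hb)
  exact ⟨fun h a ha b hb => (key a ha b hb).1 (h a ha b hb),
    fun h a ha b hb => (key a ha b hb).2 (h a ha b hb)⟩

theorem Adj.not_mSep (h : G.Adj a b) : ¬ G.MSep a b Z := by
  refine fun hs => hs ⟨[a, b], ⟨by simpa using h.ne, by simpa using h⟩, by simp, by simp, ?_⟩
  intro u v w hinf
  have := hinf.length_le
  simp at this

theorem MarkovEquiv.adj (h : MarkovEquiv G H) (hH : H.IsMAG) (hab : G.Adj a b) : H.Adj a b := by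
  by_contra hn
  obtain ⟨Z, ha, hb, hs⟩ := hH.maximal a b hab.ne hn
  exact hab.not_mSep ((h.mSep_iff hab.ne ha hb).2 hs)

theorem MarkovEquiv.adj_iff (h : MarkovEquiv G H) (hG : G.IsMAG) (hH : H.IsMAG) :
    G.Adj a b ↔ H.Adj a b := ⟨h.adj hH, h.symm.adj hG⟩

/-! ### Invariance of the colliders with order -/

theorem Adj.exists_mark (h : G.Adj a b) : ∃ m, G.mark a b = some m := Option.isSome_iff_exists.1 h

/-- Colliders with order are colliders in every Markov equivalent MAG. For `⟨a, b, c⟩` let `x` be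
the start of a discriminating walk and let `Z` separate `x` and `c`. The interior of the walk must
be in `Z`, as its vertices are colliders on the walk and parents of `c`, and `b` cannot be in `Z`;
then in an equivalent MAG, where the walk has the same colliders, `b` has to be a collider. -/
theorem OrdCol.collider_of_markovEquiv (hG : G.IsMAG) (hH : H.IsMAG) (heq : MarkovEquiv G H)
    (h : G.OrdCol a b c) : H.Collider a b c := by
  have hadj : ∀ {a b}, G.Adj a b → H.Adj a b := fun h => heq.adj hH h
  refine OrdCol.rec (motive_1 := fun a b c _ => G.Collider a b c ∧ H.Collider a b c)
    (motive_2 := fun c z y _ => G.ArrowAt z y ∧ H.ArrowAt z y ∧ G.Directed y c ∧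
      ∃ x, x ≠ c ∧ ¬ G.Adj x c ∧ ∀ Z, x ∉ Z → c ∉ Z → G.MSep x c Z →
        y ∈ Z ∧ G.Reaches x Z y Mark.arrow ∧ H.Reaches x Z y Mark.arrow)
    ?_ ?_ ?_ ?_ ?_ h |>.2
  · intro a b c hc hac
    refine ⟨hc, ?_⟩
    obtain ⟨Z, ha, hc', hs⟩ := hG.maximal a c hc.1 hac
    have hb : b ∉ Z := by
      intro hb
      obtain ⟨m, hm⟩ := hc.2.2.adj.symm.exists_mark
      refine hs.not_reaches hG.ancestral (m := m) ?_
      exact (Reaches.start hc.2.1).step hm (fun _ => subset_ancestors hb)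
        (fun h => absurd ⟨rfl, hc.2.2⟩ h)
    by_contra hn
    obtain ⟨m, hm⟩ := (hadj hc.2.1.adj).exists_mark
    obtain ⟨m', hm'⟩ := (hadj hc.2.2.adj.symm).exists_mark
    refine ((heq.mSep_iff hc.1 ha hc').1 hs).not_reaches hH.ancestral (m := m') ?_
    refine (Reaches.start hm).step hm' (fun h => ?_) fun _ => hb
    obtain ⟨rfl, h2⟩ := h
    exact absurd ⟨hc.1, hm, h2⟩ hn
  · rintro a b c hc - ⟨hbaG, hba, -, x, hxc, hxadj, hx⟩
    refine ⟨hc, ?_⟩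
    obtain ⟨Z, hxZ, hcZ, hs⟩ := hG.maximal x c hxc hxadj
    obtain ⟨haZ, hrG, hrH⟩ := hx Z hxZ hcZ hs
    have hrb := hrG.step hc.2.1 (fun _ => subset_ancestors haZ) fun h => absurd ⟨rfl, hbaG⟩ h
    have hb : b ∉ Z := by
      intro hb
      obtain ⟨m, hm⟩ := hc.2.2.adj.symm.exists_mark
      refine hs.not_reaches hG.ancestral (m := m) ?_
      exact hrb.step hm (fun _ => subset_ancestors hb) (fun h => absurd ⟨rfl, hc.2.2⟩ h)
    by_contra hn
    obtain ⟨m, hm⟩ := (hadj hc.2.1.adj).exists_mark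
    obtain ⟨m', hm'⟩ := (hadj hc.2.2.adj.symm).exists_mark
    refine ((heq.mSep_iff hxc hxZ hcZ).1 hs).not_reaches hH.ancestral (m := m') ?_
    refine (hrH.step hm (fun _ => subset_ancestors haZ) fun h => absurd ⟨rfl, hba⟩ h).step hm'
      (fun h => ?_) fun _ => hb
    obtain ⟨rfl, h2⟩ := h
    exact absurd ⟨hc.1, hm, h2⟩ hn
  · rintro a b c - ⟨h1, h2⟩
    exact ⟨h1.symm, h2.symm⟩
  · rintro c z y x hyc - hxc ⟨h1, h2⟩
    have hne : x ≠ c := fun he => hyc.not_arrowAt (he ▸ h1.2.2)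
    refine ⟨h1.2.1, h2.2.1, hyc, x, hne, hxc, fun Z _ _ hs => ⟨?_, .start h1.2.2, .start h2.2.2⟩⟩
    by_contra hy
    exact hs.not_reaches hG.ancestral
      ((Reaches.start h1.2.2).step_tail hyc.1 hyc.not_arrowAt hy)
  · rintro c z y u hyc - - ⟨h1, h2⟩ ⟨h3, h4, -, x, hxc, hxadj, hx⟩
    refine ⟨h1.2.1, h2.2.1, hyc, x, hxc, hxadj, fun Z hxZ hcZ hs => ?_⟩
    obtain ⟨hu, hrG, hrH⟩ := hx Z hxZ hcZ hs
    have hrG' := hrG.step h1.2.2 (fun _ => subset_ancestors hu) fun h => absurd ⟨rfl, h3⟩ h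
    refine ⟨?_, hrG',
      hrH.step h2.2.2 (fun _ => subset_ancestors hu) fun h => absurd ⟨rfl, h4⟩ h⟩
    by_contra hy
    exact hs.not_reaches hG.ancestral (hrG'.step_tail hyc.1 hyc.not_arrowAt hy)

theorem OrdCol.mem_invariantColliders (hG : G.IsMAG) (h : G.OrdCol a b c) :
    (a, b, c) ∈ G.invariantColliders :=
  fun _ hH heq => h.collider_of_markovEquiv hG hH heq.symm

/-! ### Colliders with order in the sense of discriminating paths -/

theorem DiscWalk.of_list {y b : V} : ∀ (qs : List V) (u v : V),
    (∀ z, G.OrdCol z v u → G.DiscWalk y z v) →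
    (∀ p q r, [p, q, r] <:+: u :: v :: (qs ++ [b]) → G.OrdCol p q r) →
    (∀ q ∈ v :: qs, G.Directed q y) → G.DiscWalk y b ((v :: qs).getLast (by simp))
  | [], u, v, hst, htr, _ => hst b (htr u v b (by simp)).symm
  | q :: qs, u, v, hst, htr, hdir => by
    rw [List.getLast_cons (by simp)]
    refine of_list qs v q (fun z hz => ?_) (fun p q' r hpr => ?_) fun q' hq' => ?_
    · refine .step (hdir q (by simp)) hz (hst q (htr u v q ?_).symm)
      exact ⟨[], qs ++ [b], by simp⟩
    · exact htr p q' r (hpr.trans (List.suffix_cons _ _).isInfix)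
    · exact hdir q' (List.mem_cons_of_mem _ hq')

theorem IsDiscriminating.discWalk {qs : List V} (h : G.IsDiscriminating x qs a b y)
    (hord : ∀ u v w, [u, v, w] <:+: x :: (qs ++ [a, b]) → G.OrdCol u v w) :
    G.DiscWalk y b a := by
  obtain ⟨-, hxy, -, hdir⟩ := h
  cases qs with
  | nil =>
    exact DiscWalk.of_list [] x a
      (fun z hz => .base (hdir a (by simp)) hz hxy) hord (by simpa using hdir)
  | cons q qs =>
    have := DiscWalk.of_list (b := b) (qs ++ [a]) x q
      (fun z hz => .base (hdir q (by simp)) hz hxy) (by simpa using hord) (by simpa using hdir)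
    simpa using this

theorem ordCol_of_mem_orderAtMost : ∀ (i : ℕ) {a b c : V}, (a, b, c) ∈ G.orderAtMost i →
    G.Collider a b c → G.OrdCol a b c
  | 0, _, _, _, h, hc => .unshielded hc h.2
  | i + 1, a, b, c, h, hc => by
    have key : ∀ {a b c}, G.DiscriminatedWithin (G.orderAtMost i) a b c → G.DiscWalk c b a := by
      rintro a b c ⟨x, qs, hd, hord⟩
      exact hd.discWalk fun u v w huvw =>
        ordCol_of_mem_orderAtMost i (hord u v w huvw) (hd.2.2.1 u v w huvw)
    rcases h with h | h | h
    · exact ordCol_of_mem_orderAtMost i h hc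
    · exact .discriminated hc (key h)
    · exact (OrdCol.discriminated hc.symm (key h)).symm

theorem ordCol_of_mem_orderedColliders (h : (a, b, c) ∈ G.orderedColliders) : G.OrdCol a b c := by
  obtain ⟨hc, i, hi⟩ := h
  refine ordCol_of_mem_orderAtMost i ?_ hc
  cases i with
  | zero => exact hi
  | succ i => exact hi.1

end MixedGraph

/-! ### Discriminating walks in graphs with the same colliders with order -/

namespace MixedGraph

variable {V : Type} {G H : MixedGraph V} {a b c s t u v w x y z : V} {A B Z : Set V}

/-- The hypotheses of the criterion for Markov equivalence: the graphs have the same adjacencies,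
and the colliders with order of each are colliders in the other. -/
structure Agree (G H : MixedGraph V) : Prop where
  adj_iff : ∀ a b, G.Adj a b ↔ H.Adj a b
  left : ∀ a b c, G.OrdCol a b c → H.Collider a b c
  right : ∀ a b c, H.OrdCol a b c → G.Collider a b c

theorem Agree.symm (h : Agree G H) : Agree H G :=
  ⟨fun a b => (h.adj_iff a b).symm, h.right, h.left⟩

/-- An edge `y → c` of `G` is directed in `H`, too, if `H` has an arrowhead from `a` at `y` and
`⟨a, y, c⟩` is certified in `H`: otherwise `⟨a, y, c⟩` would be a collider with order in `H`. -/
theorem Agree.directed (h : Agree G H) (hH : H.IsAncestral) (hcert : H.Certified a y c)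
    (hay : H.ArrowAt a y) (hne : a ≠ c) (hyc : G.Directed y c) : H.Directed y c := by
  refine hH.directed hay ((h.adj_iff _ _).1 hyc.adj) fun hc => ?_
  exact hyc.not_arrowAt (h.right _ _ _ (hcert.ordCol ⟨hne, hay, hc⟩)).2.2

theorem Agree.ordCol_and_discWalk (h : Agree G H) (hH : H.IsAncestral) :
    (∀ a b c, G.OrdCol a b c → H.OrdCol a b c) ∧
      ∀ c z y, G.DiscWalk c z y → H.DiscWalk c z y := by
  have h1 : ∀ {a b c : V}, G.Collider a b c → ¬ G.Adj a c → H.OrdCol a b c := fun hc hac =>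
    .unshielded (h.left _ _ _ (.unshielded hc hac)) (fun h' => hac ((h.adj_iff _ _).2 h'))
  have h2 : ∀ {a b c : V}, G.Collider a b c → G.DiscWalk c b a → H.DiscWalk c b a →
      H.OrdCol a b c := fun hc hd hd' =>
    .discriminated (h.left _ _ _ (.discriminated hc hd)) hd'
  have h3 : ∀ {c z y x : V}, G.Directed y c → G.OrdCol z y x → ¬ G.Adj x c → H.OrdCol z y x →
      H.DiscWalk c z y := by
    intro c z y x hyc hG' hxc ih
    have hxc' : ¬ H.Adj x c := fun h' => hxc ((h.adj_iff _ _).2 h')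
    refine .base (h.directed hH (Or.inl hxc') ih.collider.2.2 ?_ hyc) ih hxc'
    rintro rfl
    exact hyc.not_arrowAt hG'.collider.2.2
  have h4 : ∀ {c z y u : V}, G.Directed y c → G.OrdCol z y u → G.DiscWalk c y u →
      H.OrdCol z y u → H.DiscWalk c y u → H.DiscWalk c z y := by
    intro c z y u hyc hG' _ ih hd
    refine .step (h.directed hH (Or.inr hd) ih.collider.2.2 ?_ hyc) ih hd
    rintro rfl
    exact hyc.not_arrowAt hG'.collider.2.2
  exact ⟨fun a b c hc => OrdCol.rec (motive_1 := fun a b c _ => H.OrdCol a b c)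
      (motive_2 := fun c z y _ => H.DiscWalk c z y) h1 h2 (fun _ ih => ih.symm) h3 h4 hc,
    fun c z y hd => DiscWalk.rec (motive_1 := fun a b c _ => H.OrdCol a b c)
      (motive_2 := fun c z y _ => H.DiscWalk c z y) h1 h2 (fun _ ih => ih.symm) h3 h4 hd⟩

theorem Agree.certified (h : Agree G H) (hH : H.IsAncestral) (hc : G.Certified a b c) :
    H.Certified a b c :=
  hc.imp (fun hn h' => hn ((h.adj_iff _ _).2 h')) ((h.ordCol_and_discWalk hH).2 _ _ _)

theorem Agree.collider_of_certified (h : Agree G H) (hH : H.IsAncestral)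
    (hc : G.Certified a b c) (hcol : H.Collider a b c) : G.Collider a b c :=
  h.right _ _ _ ((h.certified hH hc).ordCol hcol)

/-! ### Triples on shortest routes -/

/-- The internal vertex `x m` of the route is a collider in `Z` and a parent of `w`. Only such a
vertex may cease to be passable when one of its two edges on the route is replaced by its edge
with `w`. -/
def Blocks (G : MixedGraph V) (Z : Set V) (n : ℕ) (x : ℕ → V) (w : V) (m : ℕ) : Prop :=
  0 < m ∧ m < n ∧ G.ArrowAt (x (m - 1)) (x m) ∧ G.ArrowAt (x (m + 1)) (x m) ∧ x m ∈ Z ∧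
    G.Directed (x m) w

/-- The vertices that are ancestors of `Z` or of one of `s` and `t`. -/
abbrev weakAncestors (G : MixedGraph V) (s t : V) (Z : Set V) : Set V :=
  G.ancestors (insert s (insert t Z))

namespace IsRoute

variable {n : ℕ} {x : ℕ → V}

theorem passable_left (hG : G.IsAncestral) (h : G.IsRoute (G.weakAncestors s t Z) Z s t n x)
    {m : ℕ} (h0 : 0 < m) (hm : m < n) (hw : G.Adj (x m) w) (hb : ¬ G.Blocks Z n x w m) :
    G.Passable (G.weakAncestors s t Z) Z (x (m - 1)) (x m) w := by
  have hp := h.pass_at h0 hm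
  refine ⟨fun hc => ?_, fun hc hz => ?_⟩
  · by_cases h1 : G.ArrowAt (x (m + 1)) (x m)
    · exact hp.1 ⟨hc.1, h1⟩
    · rcases h.tail_forward hG (fun _ _ => Directed.mem_ancestors) (n - m - 1) m (by omega)
        ⟨_, hc.1⟩ h1 with h2 | h2
      · exact h2
      · rw [show m + (n - m - 1) + 1 = n by omega, h.last] at h2
        exact ⟨t, by simp, h2.to_reflTransGen⟩
  · have hcol : G.ArrowAt (x (m - 1)) (x m) ∧ G.ArrowAt (x (m + 1)) (x m) := by
      by_contra h1
      exact hp.2 h1 hz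
    exact hb ⟨h0, hm, hcol.1, hcol.2, hz, hG.directed hcol.1 hw fun h' => hc ⟨hcol.1, h'⟩⟩

theorem passable_right (hG : G.IsAncestral) (h : G.IsRoute (G.weakAncestors s t Z) Z s t n x)
    {m : ℕ} (h0 : 0 < m) (hm : m < n) (hw : G.Adj (x m) w) (hb : ¬ G.Blocks Z n x w m) :
    G.Passable (G.weakAncestors s t Z) Z w (x m) (x (m + 1)) := by
  have hp := h.pass_at h0 hm
  refine ⟨fun hc => ?_, fun hc hz => ?_⟩
  · by_cases h1 : G.ArrowAt (x (m - 1)) (x m)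
    · exact hp.1 ⟨h1, hc.2⟩
    · have := h.tail_backward hG (fun _ _ => Directed.mem_ancestors) (m - 1) (by omega)
      rw [Nat.sub_add_cancel (by omega), h.first] at this
      rcases this ⟨_, hc.1⟩ h1 with h2 | h2
      · exact h2
      · exact ⟨s, by simp, h2.to_reflTransGen⟩
  · have hcol : G.ArrowAt (x (m - 1)) (x m) ∧ G.ArrowAt (x (m + 1)) (x m) := by
      by_contra h1
      exact hp.2 h1 hz
    exact hb ⟨h0, hm, hcol.1, hcol.2, hz, hG.directed hcol.1 hw fun h' => hc ⟨h', hcol.2⟩⟩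

end IsRoute

theorem exists_last_not_blocks {n : ℕ} {x : ℕ → V} {k : ℕ} (hk : 0 < k) :
    ∃ i < k, ¬ G.Blocks Z n x w i ∧ ∀ m, i < m → m < k → G.Blocks Z n x w m := by
  induction k with
  | zero => omega
  | succ k ih =>
    by_cases hb : G.Blocks Z n x w k
    · obtain ⟨i, hi, h1, h2⟩ := ih hb.1
      refine ⟨i, by omega, h1, fun m hm hmk => ?_⟩
      rcases Nat.eq_or_lt_of_le (Nat.le_of_lt_succ hmk) with rfl | h'
      · exact hb
      · exact h2 m hm h'
    · exact ⟨k, by omega, hb, fun m hm hmk => by omega⟩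

theorem exists_first_not_blocks {n : ℕ} {x : ℕ → V} {k : ℕ} (hk : k < n) :
    ∃ j, k < j ∧ j ≤ n ∧ ¬ G.Blocks Z n x w j ∧ ∀ m, k < m → m < j → G.Blocks Z n x w m := by
  classical
  have hex : ∃ j, k < j ∧ ¬ G.Blocks Z n x w j := ⟨n, hk, fun h => absurd h.2.1 (lt_irrefl n)⟩
  refine ⟨Nat.find hex, (Nat.find_spec hex).1, ?_, (Nat.find_spec hex).2, fun m h1 h2 => ?_⟩
  · exact Nat.find_min' hex ⟨hk, fun h => absurd h.2.1 (lt_irrefl n)⟩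
  · by_contra hn
    exact Nat.find_min hex h2 ⟨h1, hn⟩

/-- Going back from `x k`, the first vertex that does not block `w` is not adjacent to `w`: then
`⟨x (k - 1), x k, w⟩` is unshielded or has a discriminating walk along the route. -/
def LeftOpen (G : MixedGraph V) (Z : Set V) (n : ℕ) (x : ℕ → V) (w : V) (k : ℕ) : Prop :=
  ∃ i < k, ¬ G.Adj (x i) w ∧ ∀ m, i < m → m < k → G.Blocks Z n x w m

/-- The mirror image of `LeftOpen`. -/
def RightOpen (G : MixedGraph V) (Z : Set V) (n : ℕ) (x : ℕ → V) (w : V) (k : ℕ) : Prop :=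
  ∃ j, k < j ∧ j ≤ n ∧ ¬ G.Adj (x j) w ∧ ∀ m, k < m → m < j → G.Blocks Z n x w m

theorem certified_of_left {n : ℕ} {x : ℕ → V} {i k : ℕ} (hik : i < k) (hi : ¬ G.Adj (x i) w)
    (hb : ∀ m, i < m → m < k → G.Blocks Z n x w m)
    (hord : ∀ m, i < m → m < k → G.OrdCol (x (m - 1)) (x m) (x (m + 1))) :
    G.Certified (x (k - 1)) (x k) w := by
  have key : ∀ d, i + d + 1 < k → G.DiscWalk w (x (i + d + 2)) (x (i + d + 1)) := by
    intro d
    induction d with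
    | zero =>
      intro hd
      have hb' := hb (i + 1) (by omega) hd
      exact .base hb'.2.2.2.2.2 (hord (i + 1) (by omega) hd).symm hi
    | succ d ih =>
      intro hd
      have hb' := hb (i + d + 2) (by omega) hd
      exact .step hb'.2.2.2.2.2 (hord (i + d + 2) (by omega) hd).symm (ih (by omega))
  by_cases hk : i + 1 = k
  · subst hk
    exact Or.inl hi
  · right
    have := key (k - i - 2) (by omega)
    rwa [show i + (k - i - 2) + 2 = k by omega, show i + (k - i - 2) + 1 = k - 1 by omega] at this

theorem certified_of_right {n : ℕ} {x : ℕ → V} {j k : ℕ} (hkj : k < j) (hj : ¬ G.Adj (x j) w)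
    (hb : ∀ m, k < m → m < j → G.Blocks Z n x w m)
    (hord : ∀ m, k < m → m < j → G.OrdCol (x (m - 1)) (x m) (x (m + 1))) :
    G.Certified (x (k + 1)) (x k) w := by
  have key : ∀ d, k + d + 1 < j → G.DiscWalk w (x (j - d - 2)) (x (j - d - 1)) := by
    intro d
    induction d with
    | zero =>
      intro hd
      have hb' := hb (j - 1) (by omega) (by omega)
      have := hord (j - 1) (by omega) (by omega)
      rw [Nat.sub_add_cancel (by omega)] at this
      exact .base hb'.2.2.2.2.2 this hj
    | succ d ih =>
      intro hd
      have hb' := hb (j - (d + 1) - 1) (by omega) (by omega)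
      have := hord (j - (d + 1) - 1) (by omega) (by omega)
      rw [show j - (d + 1) - 1 + 1 = j - d - 1 by omega] at this
      exact .step hb'.2.2.2.2.2 this (ih (by omega))
  by_cases hk : k + 1 = j
  · subst hk
    exact Or.inl hj
  · right
    have := key (j - k - 2) (by omega)
    rwa [show j - (j - k - 2) - 2 = k by omega, show j - (j - k - 2) - 1 = k + 1 by omega] at this

namespace IsShortestRoute

variable {n : ℕ} {x : ℕ → V}

theorem ne (hG : G.IsAncestral) (h : G.IsShortestRoute (G.weakAncestors s t Z) Z s t n x)
    {k : ℕ} (hk : k < n) : x (k - 1) ≠ x (k + 1) :=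
  h.injective hG (fun _ _ => Directed.mem_ancestors) (by omega) (by omega)

/-- Every triple on a shortest route is unshielded, or it is the end of a discriminating walk that
runs along the route from the left or from the right. Otherwise there would be a shortcut. -/
theorem leftOpen_or_rightOpen (hG : G.IsAncestral)
    (h : G.IsShortestRoute (G.weakAncestors s t Z) Z s t n x) {k : ℕ} (h0 : 0 < k) (hk : k < n) :
    G.LeftOpen Z n x (x (k + 1)) k ∨ G.RightOpen Z n x (x (k - 1)) k := by
  obtain ⟨i, hik, hi, hib⟩ := exists_last_not_blocks (G := G) (Z := Z) (n := n) (x := x)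
    (w := x (k + 1)) h0
  obtain ⟨j, hkj, hjn, hj, hjb⟩ := exists_first_not_blocks (G := G) (Z := Z) (n := n) (x := x)
    (w := x (k - 1)) hk
  by_contra hn
  push Not at hn
  have hadj1 : G.Adj (x i) (x (k + 1)) := by
    by_contra h'
    exact hn.1 ⟨i, hik, h', hib⟩
  have hadj2 : G.Adj (x j) (x (k - 1)) := by
    by_contra h'
    exact hn.2 ⟨j, hkj, hjn, h', hjb⟩
  have d1 : G.Directed (x (k + 1)) (x (k - 1)) := by
    have hb : G.Blocks Z n x (x i) (k + 1) := by
      by_contra hb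
      refine h.not_shortcut (i := i) (j := k + 1) (by omega) (by omega) hadj1
        (fun hi0 => h.passable_left hG hi0 (by omega) hadj1 hi)
        fun hkn => h.passable_right hG (by omega) hkn hadj1.symm hb
    have hd := hb.2.2.2.2.2
    by_cases hik' : i + 1 = k
    · rwa [show k - 1 = i by omega]
    · have hb' := hib (i + 1) (by omega) (by omega)
      exact absurd hb'.2.2.1 (hG.not_arrowAt ((Relation.ReflTransGen.single hb'.2.2.2.2.2).tail hd))
  have d2 : G.Directed (x (k - 1)) (x (k + 1)) := by
    have hb : G.Blocks Z n x (x j) (k - 1) := by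
      by_contra hb
      refine h.not_shortcut (i := k - 1) (j := j) (by omega) hjn hadj2.symm
        (fun hk0 => h.passable_left hG hk0 (by omega) hadj2.symm hb)
        fun hjn' => h.passable_right hG (by omega) hjn' hadj2 hj
    have hd := hb.2.2.2.2.2
    by_cases hjk' : j = k + 1
    · rwa [← hjk']
    · have hb' := hjb (j - 1) (by omega) (by omega)
      have harr := hb'.2.2.2.1
      rw [Nat.sub_add_cancel (by omega)] at harr
      exact absurd harr (hG.not_arrowAt ((Relation.ReflTransGen.single hb'.2.2.2.2.2).tail hd))
  exact d1.not_arrowAt d2.arrowAt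

/-- Two triples of a shortest route in a MAG cannot be discriminated along the route by walks that
contain each other's last triple: the part of the route around both would be an inducing path, and
the edge between its ends a shortcut. -/
theorem not_mutually_open (hG : G.IsMAG)
    (h : G.IsShortestRoute (G.weakAncestors s t Z) Z s t n x) {j k : ℕ} (h0 : 0 < j) (hjk : j < k)
    (hk : k < n) (hj : G.ArrowAt (x (j - 1)) (x j)) (hk' : G.ArrowAt (x (k + 1)) (x k))
    (hleft : ∀ m, j ≤ m → m < k → G.Blocks Z n x (x (k + 1)) m)
    (hright : ∀ m, j < m → m ≤ k → G.Blocks Z n x (x (j - 1)) m) : False := by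
  have hA := hG.ancestral
  have dj := (hleft j le_rfl hjk).2.2.2.2.2
  have dk := (hright k hjk le_rfl).2.2.2.2.2
  have hadj : G.Adj (x (j - 1)) (x (k + 1)) := by
    have := hG.adj_of_inducing (n := k + 2 - j) (x := fun m => x (j - 1 + m))
      (fun i hi => h.adj _ (by omega)) ?_ ?_ ?_
    · simpa [show j - 1 + (k + 2 - j) = k + 1 by omega] using this
    · simp only [Nat.add_zero, show j - 1 + (k + 2 - j) = k + 1 by omega]
      exact h.injective hA (fun _ _ => Directed.mem_ancestors) (by omega) (by omega)
    · intro i hi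
      simp only [show j - 1 + (i + 1) = j + i by omega, show j - 1 + (i + 2) = j + i + 1 by omega,
        show j - 1 + i = j + i - 1 by omega]
      constructor
      · rcases Nat.eq_zero_or_pos i with rfl | hi0
        · simpa using hj
        · exact (hright (j + i) (by omega) (by omega)).2.2.1
      · rcases Nat.eq_or_lt_of_le (show j + i ≤ k by omega) with hik | hik
        · rw [hik]
          exact hk'
        · exact (hleft (j + i) (by omega) hik).2.2.2.1
    · intro i hi
      simp only [show j - 1 + (i + 1) = j + i by omega, Nat.add_zero,
        show j - 1 + (k + 2 - j) = k + 1 by omega]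
      rcases Nat.eq_or_lt_of_le (show j + i ≤ k by omega) with hik | hik
      · rw [hik]
        exact Or.inl (.single dk)
      · exact Or.inr (.single (hleft (j + i) (by omega) hik).2.2.2.2.2)
  refine h.not_shortcut (i := j - 1) (j := k + 1) (by omega) (by omega) hadj
    (fun hj0 => h.passable_left hA hj0 (by omega) hadj fun hb => ?_)
    fun hkn => h.passable_right hA (by omega) hkn hadj.symm fun hb => ?_
  · exact hA.not_arrowAt ((Relation.ReflTransGen.single dk).tail hb.2.2.2.2.2) hk'
  · exact hA.not_arrowAt ((Relation.ReflTransGen.single dj).tail hb.2.2.2.2.2) hj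

/-- Every collider on a shortest route in a MAG is a collider with order. A collider without order
depends, along a discriminating walk, on another one; the leftmost depends on one to its right,
the rightmost on one to its left, so that two of them depend on each other, against
`not_mutually_open`. -/
theorem ordCol (hG : G.IsMAG) (h : G.IsShortestRoute (G.weakAncestors s t Z) Z s t n x) {k : ℕ}
    (h0 : 0 < k) (hk : k < n) (h1 : G.ArrowAt (x (k - 1)) (x k))
    (h2 : G.ArrowAt (x (k + 1)) (x k)) : G.OrdCol (x (k - 1)) (x k) (x (k + 1)) := by
  classical
  have hA := hG.ancestral
  let U : ℕ → Prop := fun m => 0 < m ∧ m < n ∧ G.ArrowAt (x (m - 1)) (x m) ∧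
    G.ArrowAt (x (m + 1)) (x m) ∧ ¬ G.OrdCol (x (m - 1)) (x m) (x (m + 1))
  have hleft : ∀ m, U m → G.LeftOpen Z n x (x (m + 1)) m → ∃ i < m, U i ∧
      ∀ l, i ≤ l → l < m → G.Blocks Z n x (x (m + 1)) l := by
    rintro m ⟨hm0, hmn, ha, hb, hno⟩ ⟨i, him, hi, hib⟩
    by_contra hcon
    push Not at hcon
    refine hno ((certified_of_left him hi hib fun l hl hlm => ?_).ordCol ⟨h.ne hA hmn, ha, hb⟩)
    by_contra hl'
    obtain ⟨-, hln, hla, hlb, -⟩ := hib l hl hlm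
    obtain ⟨r, hlr, hrm, hr⟩ := hcon l hlm ⟨by omega, hln, hla, hlb, hl'⟩
    exact hr (hib r (by omega) hrm)
  have hright : ∀ m, U m → G.RightOpen Z n x (x (m - 1)) m → ∃ j, m < j ∧ U j ∧
      ∀ l, m < l → l ≤ j → G.Blocks Z n x (x (m - 1)) l := by
    rintro m ⟨hm0, hmn, ha, hb, hno⟩ ⟨j, hmj, -, hj, hjb⟩
    by_contra hcon
    push Not at hcon
    refine hno ((certified_of_right hmj hj hjb fun l hl hlj => ?_).ordCol
      ⟨(h.ne hA hmn).symm, hb, ha⟩).symm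
    by_contra hl'
    obtain ⟨-, hln, hla, hlb, -⟩ := hjb l hl hlj
    obtain ⟨r, hmr, hrl, hr⟩ := hcon l hl ⟨by omega, hln, hla, hlb, hl'⟩
    exact hr (hjb r hmr (by omega))
  have hor : ∀ m, U m → ¬ G.LeftOpen Z n x (x (m + 1)) m → G.RightOpen Z n x (x (m - 1)) m :=
    fun m hm => (h.leftOpen_or_rightOpen hA hm.1 hm.2.1).resolve_left
  by_contra hno
  have hUk : U k := ⟨h0, hk, h1, h2, hno⟩
  have hex : ∃ m, U m ∧ G.LeftOpen Z n x (x (m + 1)) m := by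
    have hmax : U (Nat.findGreatest U n) := Nat.findGreatest_spec hk.le hUk
    refine ⟨_, hmax, ?_⟩
    by_contra hl
    obtain ⟨j, hj, hUj, -⟩ := hright _ hmax (hor _ hmax hl)
    exact absurd (Nat.le_findGreatest hUj.2.1.le hUj) (by omega)
  obtain ⟨⟨hm, hml⟩, hmin⟩ := And.intro (Nat.find_spec hex) fun i => Nat.find_min (m := i) hex
  set m := Nat.find hex
  obtain ⟨i, him, hi⟩ := hleft m hm hml
  -- The last such `j` before `m`: what it depends on to its right lies beyond `m`.
  let Q : ℕ → Prop := fun j => j < m ∧ U j ∧ ∀ l, j ≤ l → l < m → G.Blocks Z n x (x (m + 1)) l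
  obtain ⟨hjm, hUj, hjb⟩ : Q (Nat.findGreatest Q m) := Nat.findGreatest_spec him.le ⟨him, hi⟩
  set j := Nat.findGreatest Q m with hjdef
  obtain ⟨r, hjr, hUr, hrb⟩ := hright j hUj (hor j hUj fun hl => hmin j hjm ⟨hUj, hl⟩)
  have hmr : m ≤ r := by
    by_contra hrm
    have hQ : Q r := ⟨by omega, hUr, fun l hl => hjb l (by omega)⟩
    exact absurd (Nat.le_findGreatest (by omega : r ≤ m) hQ) (by omega)
  exact h.not_mutually_open hG hUj.1 hjm hm.2.1 hUj.2.2.1 hm.2.2.2.1 hjb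
    fun l h1 h2 => hrb l h1 (by omega)

end IsShortestRoute

end MixedGraph

/-! ### The criterion for Markov equivalence -/

namespace MixedGraph

variable {V : Type} {G H : MixedGraph V} {a b c s t u v w y z : V} {A B Z : Set V}

/-- There is a directed walk with `m` edges from `v` to a member of `B`. -/
def WalksInto (G : MixedGraph V) (B : Set V) : ℕ → V → Prop
  | 0, v => v ∈ B
  | m + 1, v => ∃ w, G.Directed v w ∧ G.WalksInto B m w

/-- The length of a shortest directed path from `v` to a member of `B`, and `0` if there is
none. -/
noncomputable def depth (G : MixedGraph V) (B : Set V) (v : V) : ℕ := sInf {m | G.WalksInto B m v}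

theorem exists_walksInto (hv : v ∈ G.ancestors B) : ∃ m, G.WalksInto B m v := by
  obtain ⟨b, hb, hvb⟩ := hv
  induction hvb using Relation.ReflTransGen.head_induction_on with
  | refl => exact ⟨0, hb⟩
  | head h _ ih =>
    obtain ⟨m, hm⟩ := ih
    exact ⟨m + 1, _, h, hm⟩

theorem WalksInto.mem_ancestors : ∀ {m : ℕ} {v : V}, G.WalksInto B m v → v ∈ G.ancestors B
  | 0, _, h => subset_ancestors h
  | _ + 1, _, ⟨_, hd, h⟩ => hd.mem_ancestors (WalksInto.mem_ancestors h)

theorem walksInto_depth (hv : v ∈ G.ancestors B) : G.WalksInto B (G.depth B v) v :=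
  Nat.sInf_mem (exists_walksInto hv)

theorem depth_le {m : ℕ} (h : G.WalksInto B m v) : G.depth B v ≤ m := Nat.sInf_le h

theorem Directed.depth_le_succ (h : G.Directed v w) (hw : w ∈ G.ancestors B) :
    G.depth B v ≤ G.depth B w + 1 :=
  depth_le ⟨w, h, walksInto_depth hw⟩

theorem exists_directed_depth (hv : v ∈ G.ancestors B) (hvB : v ∉ B) :
    ∃ w, G.Directed v w ∧ w ∈ G.ancestors B ∧ G.depth B v = G.depth B w + 1 := by
  have h := walksInto_depth hv
  cases hm : G.depth B v with
  | zero =>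
    rw [hm] at h
    exact absurd h hvB
  | succ m =>
    rw [hm] at h
    obtain ⟨w, hvw, hw⟩ := h
    have h1 := hvw.depth_le_succ hw.mem_ancestors
    have h2 := depth_le hw
    exact ⟨w, hvw, hw.mem_ancestors, by omega⟩

/-- A shortest directed path from `u` to `B` with first edge `u → w` stays directed in `H` if this
edge does: all triples on the path are unshielded noncolliders. -/
theorem Agree.mem_ancestors_of_depth (h : Agree G H) (hG : G.IsAncestral) (hH : H.IsAncestral) :
    ∀ (m : ℕ) {u w : V}, G.Directed u w → H.Directed u w → w ∈ G.ancestors B →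
      G.depth B w = m → G.depth B u = m + 1 → w ∈ H.ancestors B := by
  intro m
  induction m with
  | zero =>
    intro u w _ _ hw hm _
    have := walksInto_depth hw
    rw [hm] at this
    exact subset_ancestors this
  | succ m ih =>
    intro u w huw huw' hw hm hu
    by_cases hwB : w ∈ B
    · exact subset_ancestors hwB
    obtain ⟨w', hww', hw', hm'⟩ := exists_directed_depth hw hwB
    have hnadj : ¬ G.Adj u w' := fun hadj => by
      have := (hG.directed_of_directed huw hww' hadj).depth_le_succ hw'
      omega
    have hne : u ≠ w' := by
      rintro rfl
      exact hww'.not_arrowAt huw.arrowAt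
    have hd : H.Directed w w' := h.directed hH
      (Or.inl fun h' => hnadj ((h.adj_iff _ _).2 h')) huw'.arrowAt hne hww'
    exact hd.mem_ancestors (ih hww' hd hw' (by omega) hm)

/-- The sum of the depths of the colliders on a route. -/
noncomputable def colliderDepth (G : MixedGraph V) (B : Set V) (n : ℕ) (x : ℕ → V) : ℕ := by
  classical
  exact ∑ k ∈ Finset.range n,
    if 0 < k ∧ G.ArrowAt (x (k - 1)) (x k) ∧ G.ArrowAt (x (k + 1)) (x k) then G.depth B (x k) else 0

/-- If a collider on a shortest route has a child `w` such that the route is neither open to the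
left nor to the right with respect to `w`, then `w` can take its place. -/
theorem IsShortestRoute.exists_colliderDepth_lt {n : ℕ} {x : ℕ → V} (hG : G.IsAncestral)
    (h : G.IsShortestRoute (G.weakAncestors s t Z) Z s t n x) {k : ℕ} (h0 : 0 < k) (hk : k < n)
    (h1 : G.ArrowAt (x (k - 1)) (x k)) (h2 : G.ArrowAt (x (k + 1)) (x k))
    (hw : G.Directed (x k) w) (hwA : w ∈ G.weakAncestors s t Z)
    (hdepth : G.depth B w < G.depth B (x k))
    (hl : ¬ G.LeftOpen Z n x w k) (hr : ¬ G.RightOpen Z n x w k) :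
    ∃ y, G.IsShortestRoute (G.weakAncestors s t Z) Z s t n y ∧
      G.colliderDepth B n y < G.colliderDepth B n x := by
  classical
  obtain ⟨i, hik, hi, hib⟩ := exists_last_not_blocks (G := G) (Z := Z) (n := n) (x := x)
    (w := w) h0
  obtain ⟨j, hkj, hjn, hj, hjb⟩ := exists_first_not_blocks (G := G) (Z := Z) (n := n) (x := x)
    (w := w) hk
  have hadj1 : G.Adj (x i) w := by
    by_contra h'
    exact hl ⟨i, hik, h', hib⟩
  have hadj2 : G.Adj (x j) w := by
    by_contra h'
    exact hr ⟨j, hkj, hjn, h', hjb⟩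
  have ha1 : G.ArrowAt (x i) w := by
    by_cases hik' : i + 1 = k
    · exact hG.arrowAt_of_directed (by rwa [show i = k - 1 by omega]) hw hadj1
    · have hb := hib (i + 1) (by omega) (by omega)
      exact hG.arrowAt_of_directed hb.2.2.1 hb.2.2.2.2.2 hadj1
  have ha2 : G.ArrowAt (x j) w := by
    by_cases hjk' : k + 1 = j
    · exact hG.arrowAt_of_directed (by rwa [← hjk']) hw hadj2
    · have hb := hjb (j - 1) (by omega) (by omega)
      have harr := hb.2.2.2.1
      rw [Nat.sub_add_cancel (by omega)] at harr
      exact hG.arrowAt_of_directed harr hb.2.2.2.2.2 hadj2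
  have hroute := (h.take (i := i) (by omega)).join
    ((IsRoute.single w).join (h.drop hjn) hadj2.symm (by simp)
      fun hj' => h.passable_right hG (by omega) (by omega) hadj2 hj) hadj1
    (fun hi' => h.passable_left hG hi' (by omega) hadj1 hi)
    fun _ => by simpa using ⟨fun _ => hwA, fun hc => absurd ⟨ha1, ha2⟩ hc⟩
  have hlen := h.shortest _ _ hroute
  obtain rfl : j = k + 1 := by omega
  obtain rfl : i = k - 1 := by omega
  have hy : G.IsRoute (G.weakAncestors s t Z) Z s t n (Function.update x k w) := by
    convert hroute using 1
    · omega
    · funext m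
      rcases lt_trichotomy m k with hm | rfl | hm
      · simp [hm.ne, show m ≤ k - 1 by omega]
      · simp [show ¬ m ≤ m - 1 by omega, show m - (m - 1 + 1) = 0 by omega]
      · simp [hm.ne', show ¬ m ≤ k - 1 by omega, show m - (k - 1 + 1) ≠ 0 by omega,
          show k + 1 + (m - (k - 1 + 1) - 1) = m by omega]
  refine ⟨_, ⟨hy, h.shortest⟩, ?_⟩
  -- An arrowhead from `w` at a neighbor `u` of `x k` on the route is one from `x k`, too.
  have hkeep : ∀ u, G.ArrowAt u (x k) → G.ArrowAt w u → G.ArrowAt (x k) u := by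
    intro u hu hwu
    by_contra hn
    exact hG.not_arrowAt
      ((Relation.ReflTransGen.single ⟨hu, hu.adj.symm.mark_eq_tail hn⟩).tail hw) hwu
  refine Finset.sum_lt_sum (fun m hm => ?_) ⟨k, by simpa using hk, ?_⟩
  · by_cases hmk : m = k
    · subst hmk
      rw [if_pos (show 0 < m ∧ G.ArrowAt (x (m - 1)) (x m) ∧ G.ArrowAt (x (m + 1)) (x m) from
        ⟨h0, h1, h2⟩)]
      split_ifs
      · simpa using hdepth.le
      · exact Nat.zero_le _
    · split_ifs with c1 c2
      · simp [hmk]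
      · refine absurd ⟨c1.1, ?_, ?_⟩ c2
        · have := c1.2.1
          by_cases hmk' : m = k + 1
          · subst hmk'
            simp only [Nat.add_sub_cancel, Function.update_self, ne_eq, Nat.add_eq_left,
              one_ne_zero, not_false_eq_true, Function.update_of_ne] at this ⊢
            exact hkeep _ h2 this
          · simpa [show m - 1 ≠ k by omega, hmk] using this
        · have := c1.2.2
          by_cases hmk' : m + 1 = k
          · subst hmk'
            rw [Function.update_self, Function.update_of_ne hmk] at this
            exact hkeep _ h1 this
          · simpa [hmk', hmk] using this
      · exact Nat.zero_le _
      · exact le_rfl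
  · rw [if_pos (show 0 < k ∧ G.ArrowAt (x (k - 1)) (x k) ∧ G.ArrowAt (x (k + 1)) (x k) from
      ⟨h0, h1, h2⟩)]
    split_ifs
    · simpa using hdepth
    · omega

/-- A route of `G` that is as short as possible, and among these has the least sum of the depths
of its colliders, is a route of `H`. -/
theorem Agree.exists_route (h : Agree G H) (hG : G.IsMAG) (hH : H.IsMAG) {n : ℕ} {x : ℕ → V}
    (hx : G.IsRoute (G.weakAncestors s t Z) Z s t n x) :
    ∃ n x, H.IsRoute (H.weakAncestors s t Z) Z s t n x := by
  classical
  have hGA := hG.ancestral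
  have hHA := hH.ancestral
  obtain ⟨n, x, hx⟩ := hx.exists_shortest
  have hex : ∃ N x, G.IsShortestRoute (G.weakAncestors s t Z) Z s t n x ∧
    G.colliderDepth (insert s (insert t Z)) n x = N := ⟨_, x, hx, rfl⟩
  obtain ⟨y, hy, hN⟩ := Nat.find_spec hex
  have hmin : ∀ z, G.IsShortestRoute (G.weakAncestors s t Z) Z s t n z →
      ¬ G.colliderDepth (insert s (insert t Z)) n z < G.colliderDepth (insert s (insert t Z)) n y :=
    fun z hz hlt => Nat.find_min hex (hN ▸ hlt) ⟨z, hz, rfl⟩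
  have hord : ∀ m w, G.Blocks Z n y w m → G.OrdCol (y (m - 1)) (y m) (y (m + 1)) :=
    fun m w hb => hy.ordCol hG hb.1 hb.2.1 hb.2.2.1 hb.2.2.2.1
  have hcl : ∀ {k w}, G.LeftOpen Z n y w k → G.Certified (y (k - 1)) (y k) w := by
    rintro k w ⟨i, hik, hi, hib⟩
    exact certified_of_left hik hi hib fun m h1 h2 => hord m w (hib m h1 h2)
  have hcr : ∀ {k w}, G.RightOpen Z n y w k → G.Certified (y (k + 1)) (y k) w := by
    rintro k w ⟨i, hik, -, hi, hib⟩
    exact certified_of_right hik hi hib fun m h1 h2 => hord m w (hib m h1 h2)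
  refine ⟨n, y, hy.first, hy.last, fun i hi => (h.adj_iff _ _).1 (hy.adj i hi), fun i hi => ?_⟩
  have hne := hy.ne hGA hi
  have hiff : G.ArrowAt (y i) (y (i + 1)) ∧ G.ArrowAt (y (i + 2)) (y (i + 1)) ↔
      H.ArrowAt (y i) (y (i + 1)) ∧ H.ArrowAt (y (i + 2)) (y (i + 1)) := by
    refine ⟨fun hc => (h.left _ _ _ (hy.ordCol hG (Nat.succ_pos i) hi hc.1 hc.2)).2, fun hc => ?_⟩
    rcases hy.leftOpen_or_rightOpen hGA (Nat.succ_pos i) hi with ho | ho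
    · exact (h.collider_of_certified hHA (hcl ho) ⟨hne, hc⟩).2
    · exact (h.collider_of_certified hHA (hcr ho) ⟨hne.symm, hc.symm⟩).2.symm
  refine ⟨fun hc => ?_, fun hc => (hy.pass i hi).2 (by rwa [hiff])⟩
  have hcG := hiff.2 hc
  have hA := (hy.pass i hi).1 hcG
  by_cases hB : y (i + 1) ∈ insert s (insert t Z)
  · exact subset_ancestors hB
  obtain ⟨w, hw, hwA, hd⟩ := exists_directed_depth hA hB
  have hwH : H.Directed (y (i + 1)) w := by
    by_cases hl : G.LeftOpen Z n y w (i + 1)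
    · refine h.directed hHA (h.certified hHA (hcl hl)) hc.1 ?_ hw
      rintro rfl
      exact hw.not_arrowAt hcG.1
    by_cases hr : G.RightOpen Z n y w (i + 1)
    · refine h.directed hHA (h.certified hHA (hcr hr)) hc.2 ?_ hw
      rintro rfl
      exact hw.not_arrowAt hcG.2
    have hlt : G.depth (insert s (insert t Z)) w < G.depth (insert s (insert t Z)) (y (i + 1)) := by
      omega
    obtain ⟨z, hz, hlt⟩ := hy.exists_colliderDepth_lt hGA (Nat.succ_pos i) hi hcG.1 hcG.2 hw hwA
      hlt hl hr
    exact absurd hlt (hmin z hz)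
  exact hwH.mem_ancestors (h.mem_ancestors_of_depth hGA hHA _ hw hwH hwA rfl hd)

theorem Agree.mSep (h : Agree G H) (hG : G.IsMAG) (hH : H.IsMAG) (hst : s ≠ t)
    (hs : H.MSep s t Z) : G.MSep s t Z := by
  rintro ⟨π, hπ⟩
  obtain ⟨n, x, hx⟩ := hπ.exists_route
  obtain ⟨n, x, hx⟩ := h.exists_route hG hH
    (hx.mono fun v ⟨b, hb, hvb⟩ => ⟨b, by simp [hb], hvb⟩)
  obtain ⟨m, hm⟩ := hx.exists_reaches hst
  exact hs.not_reaches hH.ancestral hm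

/-- MAGs with the same adjacencies and the same colliders with order are Markov equivalent. -/
theorem Agree.markovEquiv (h : Agree G H) (hG : G.IsMAG) (hH : H.IsMAG) : MarkovEquiv G H :=
  markovEquiv_of_mSep_iff fun _ _ _ hab _ _ =>
    ⟨h.symm.mSep hH hG hab, h.mSep hG hH hab⟩

theorem markovEquiv_iff_agree (hG : G.IsMAG) (hH : H.IsMAG) : MarkovEquiv G H ↔ Agree G H :=
  ⟨fun h => ⟨fun _ _ => h.adj_iff hG hH, fun _ _ _ hc => hc.collider_of_markovEquiv hG hH h,
    fun _ _ _ hc => hc.collider_of_markovEquiv hH hG h.symm⟩, fun h => h.markovEquiv hG hH⟩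

end MixedGraph

/-! ### Reasoning about results and step counts -/

namespace Comp

variable {α β σ : Type}

/-- The computation `x` terminates after at most `B` steps, with a result that satisfies `P`. -/
def Ensures (x : Comp α) (P : α → Prop) (B : ℕ) : Prop :=
  ∃ a t, x.HaltsWith a t ∧ P a ∧ t ≤ B

theorem haltsWith_pure {a : α} : (pure a : Comp α).HaltsWith a 0 := Part.mem_some _

theorem haltsWith_step {a : α} : (step a).HaltsWith a 1 := Part.mem_some _

theorem HaltsWith.bind {x : Comp α} {f : α → Comp β} {a : α} {b : β} {t₁ t₂ : ℕ}
    (hx : x.HaltsWith a t₁) (hf : (f a).HaltsWith b t₂) : (x >>= f).HaltsWith b (t₁ + t₂) :=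
  Part.mem_bind_iff.2 ⟨(a, t₁), hx, (Part.mem_map_iff _).2 ⟨(b, t₂), hf, rfl⟩⟩

namespace Ensures

variable {P : α → Prop} {Q : β → Prop} {B B₁ B₂ : ℕ} {x : Comp α}

theorem pure {a : α} (h : P a) : Ensures (Pure.pure a) P B :=
  ⟨a, 0, haltsWith_pure, h, Nat.zero_le _⟩

theorem step {a : α} (h : P a) : Ensures (Comp.step a) P 1 := ⟨a, 1, haltsWith_step, h, le_rfl⟩

theorem mono {P' : α → Prop} (h : Ensures x P B₁) (hP : ∀ a, P a → P' a) (hB : B₁ ≤ B₂) :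
    Ensures x P' B₂ := by
  obtain ⟨a, t, h1, h2, h3⟩ := h
  exact ⟨a, t, h1, hP a h2, h3.trans hB⟩

theorem bind {f : α → Comp β} (hx : Ensures x P B₁) (hf : ∀ a, P a → Ensures (f a) Q B₂)
    (hB : B₁ + B₂ ≤ B) : Ensures (x >>= f) Q B := by
  obtain ⟨a, t, h1, h2, h3⟩ := hx
  obtain ⟨b, t', h1', h2', h3'⟩ := hf a h2
  exact ⟨b, t + t', h1.bind h1', h2', by omega⟩

/-- The rule for `bind` for a first computation with the known result `a`. -/
theorem bind_eq {f : α → Comp β} {a : α} (hx : Ensures x (· = a) B₁) (hf : Ensures (f a) Q B₂)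
    (hB : B₁ + B₂ ≤ B) : Ensures (x >>= f) Q B :=
  hx.bind (fun _ h => h ▸ hf) hB

theorem step_bind {f : α → Comp β} {a : α} (hf : Ensures (f a) Q B₁) (hB : 1 + B₁ ≤ B) :
    Ensures (Comp.step a >>= f) Q B :=
  (step rfl : Ensures _ (· = a) 1).bind_eq hf hB

/-- A loop over `l` whose body computes the function `f`, in at most `c a` steps for the
element `a`. -/
theorem forEach {body : σ → α → Comp σ} (f : σ → α → σ) (c : α → ℕ)
    (h : ∀ s, ∀ a, Ensures (body s a) (· = f s a) (c a)) : ∀ (l : List α) (s : σ),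
      Ensures (Comp.forEach l s body) (· = l.foldl f s) ((l.map fun a => c a + 1).sum)
  | [], _ => pure rfl
  | a :: l, s =>
    step_bind ((h s a).bind_eq (forEach f c h l (f s a)) le_rfl) (by simp; omega)

theorem forEach_const {body : σ → α → Comp σ} (f : σ → α → σ) (c : ℕ)
    (h : ∀ s a, Ensures (body s a) (· = f s a) c) (l : List α) (s : σ)
    (hB : l.length * (c + 1) ≤ B) : Ensures (Comp.forEach l s body) (· = l.foldl f s) B :=
  (forEach f (fun _ => c) h l s).mono (fun _ h => h) (by simpa using hB)

/-- A `repeat` loop with the invariant `I`, amortized by the potential `φ`. -/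
theorem repeatUntil {body : σ → Comp (σ × Bool)} {P I : σ → Prop} (φ b : σ → ℕ)
    (h : ∀ s, I s → Ensures (body s)
      (fun q => (q.2 = true → P q.1 ∧ b s ≤ φ s) ∧
        (q.2 = false → I q.1 ∧ b s + φ q.1 ≤ φ s ∧ 0 < b s)) (b s)) (s : σ) (hs : I s) :
    Ensures (Comp.repeatUntil body s) P (φ s) := by
  suffices key : ∀ (N : ℕ) (s : σ) (t : ℕ), φ s ≤ N → I s →
      ∃ a t', (a, t') ∈ (iteration body).fix (s, t) ∧ P a ∧ t' ≤ t + φ s by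
    obtain ⟨a, t', h1, h2, h3⟩ := key _ s 0 le_rfl hs
    exact ⟨a, t', h1, h2, by simpa using h3⟩
  intro N
  induction N with
  | zero =>
    intro s t hN hs
    obtain ⟨⟨s', d⟩, t', h1, ⟨h2, h2'⟩, h3⟩ := h s hs
    cases d with
    | true =>
      obtain ⟨hP, hb⟩ := h2 rfl
      refine ⟨s', t + t', PFun.mem_fix_iff.2 (Or.inl ?_), hP, by omega⟩
      exact (Part.mem_map_iff _).2 ⟨_, h1, by simp⟩
    | false =>
      obtain ⟨-, h4, h5⟩ := h2' rfl
      simp only at h4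
      omega
  | succ N ih =>
    intro s t hN hs
    obtain ⟨⟨s', d⟩, t', h1, ⟨h2, h2'⟩, h3⟩ := h s hs
    cases d with
    | true =>
      obtain ⟨hP, hb⟩ := h2 rfl
      refine ⟨s', t + t', PFun.mem_fix_iff.2 (Or.inl ?_), hP, by omega⟩
      exact (Part.mem_map_iff _).2 ⟨_, h1, by simp⟩
    | false =>
      obtain ⟨hI, h4, h5⟩ := h2' rfl
      simp only at h4
      obtain ⟨a, t'', h6, h7, h8⟩ := ih s' (t + t') (by omega) hI
      refine ⟨a, t'', PFun.mem_fix_iff.2 (Or.inr ⟨(s', t + t'), ?_, h6⟩), h7, by omega⟩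
      exact (Part.mem_map_iff _).2 ⟨_, h1, by simp⟩

end Ensures

end Comp

/-! ### Breadth-first search -/

namespace Algorithm

open Comp

section Reachable

variable {W : Type} [DecidableEq W]

/-- The effect of following one edge with head `w` in the search: the state consists of the flags
and of the list of the elements flagged in the present round. -/
def visit (q : Table W Bool × List W) (w : W) : Table W Bool × List W :=
  if q.1 w then q else (Function.update q.1 w true, w :: q.2)

theorem visit_foldl (f : Table W Bool) : ∀ (l : List W) (q : Table W Bool × List W),
    q.2.Nodup → (∀ w, q.1 w = true ↔ f w = true ∨ w ∈ q.2) → (∀ w ∈ q.2, f w = false) →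
    (l.foldl visit q).2.Nodup ∧ (l.foldl visit q).2.length ≤ q.2.length + l.length ∧
      (∀ w, (l.foldl visit q).1 w = true ↔ f w = true ∨ w ∈ (l.foldl visit q).2) ∧
      (∀ w ∈ (l.foldl visit q).2, f w = false) ∧
      (∀ w, (l.foldl visit q).1 w = true ↔ q.1 w = true ∨ w ∈ l)
  | [], q, h1, h2, h3 => ⟨h1, by simp, h2, h3, by simp⟩
  | w :: l, q, h1, h2, h3 => by
    rw [List.foldl_cons]
    by_cases hw : q.1 w = true
    · have hv : visit q w = q := by simp [visit, hw]
      rw [hv]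
      obtain ⟨g1, g2, g3, g4, g5⟩ := visit_foldl f l q h1 h2 h3
      refine ⟨g1, by simp; omega, g3, g4, fun w' => ?_⟩
      rw [g5, List.mem_cons]
      constructor
      · tauto
      · rintro (h | rfl | h)
        · exact Or.inl h
        · exact Or.inl hw
        · exact Or.inr h
    · have hv : visit q w = (Function.update q.1 w true, w :: q.2) := by simp [visit, hw]
      rw [hv]
      have hw' := hw
      rw [h2, not_or] at hw'
      obtain ⟨g1, g2, g3, g4, g5⟩ := visit_foldl f l (Function.update q.1 w true, w :: q.2)
        (List.nodup_cons.2 ⟨hw'.2, h1⟩)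
        (fun v => by
          by_cases hv : v = w
          · simp [hv]
          · simp [hv, h2])
        (fun v hv => by
          rcases List.mem_cons.1 hv with rfl | hv
          · simpa using hw'.1
          · exact h3 v hv)
      refine ⟨g1, by simp at g2 ⊢; omega, g3, g4, fun v => ?_⟩
      rw [g5, List.mem_cons]
      by_cases hv : v = w
      · simp [hv]
      · simp [hv]

variable [Fintype W]

/-- The potential of the search: the lists of edges that start in the elements of the front or in
elements that are not yet flagged still have to be read. The cost of treating an element of the
front is charged to the edge by which it was found. -/
def searchPotential (out : Table W (List W)) (p : Table W Bool × List W) : ℕ :=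
  1 + 3 * p.2.length + 8 * ((p.2.map fun w => (out w).length).sum +
    ∑ w with p.1 w = false, (out w).length)

theorem ensures_reachable (out : Table W (List W)) (w₀ : W) :
    Ensures (reachable out w₀)
      (fun s => ∀ w, s w = true ↔ Relation.ReflTransGen (fun v w => w ∈ out v) w₀ w)
      (8 * (∑ w, (out w).length) + 7) := by
  set E : W → W → Prop := fun v w => w ∈ out v with hE
  unfold reachable
  refine Ensures.step_bind (B₁ := 8 * (∑ w, (out w).length) + 6) ?_ (by omega)
  refine Ensures.step_bind (B₁ := 8 * (∑ w, (out w).length) + 5) ?_ (by omega)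
  refine Ensures.step_bind (B₁ := 8 * (∑ w, (out w).length) + 4) ?_ (by omega)
  let I : Table W Bool × List W → Prop := fun p =>
    p.2 ≠ [] ∧ p.2.Nodup ∧ (∀ w ∈ p.2, p.1 w = true) ∧ p.1 w₀ = true ∧
    (∀ w, p.1 w = true → Relation.ReflTransGen E w₀ w) ∧
    ∀ w, p.1 w = true → w ∉ p.2 → ∀ v ∈ out w, p.1 v = true
  refine Ensures.bind (Ensures.repeatUntil (I := I)
    (P := fun p => ∀ w, p.1 w = true ↔ Relation.ReflTransGen E w₀ w)
    (searchPotential out)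
    (fun p => 1 + 2 * p.2.length + 4 * (p.2.map fun w => (out w).length).sum) ?_ _ ?_)
    (fun p hp => Ensures.pure hp (B := 0)) ?_
  · rintro ⟨f, front⟩ ⟨i1, i2, i3, i4, i5, i6⟩
    refine Ensures.bind_eq (B₁ := 2 * front.length + 4 * (front.map fun w => (out w).length).sum)
      (B₂ := 1)
      (a := (front.flatMap out).foldl visit (f, [])) ?_ ?_ (by simp only; omega)
    · refine (Ensures.forEach (fun q w => (out w).foldl visit q)
        (fun w => 1 + 4 * (out w).length) (fun q w => ?_) front (f, [])).mono ?_ ?_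
      · refine Ensures.step_bind (Ensures.forEach_const visit 3 ?_ _ _ le_rfl) (by omega)
        intro q v
        refine Ensures.step_bind (B₁ := 2) ?_ (by omega)
        by_cases hv : q.1 v = true
        · rw [if_pos hv]
          exact Ensures.pure (by simp [visit, hv])
        · rw [if_neg hv]
          refine Ensures.step_bind (Ensures.step_bind (Ensures.pure (B := 0) ?_) le_rfl) le_rfl
          simp [visit, hv]
      · rintro _ rfl
        rw [List.foldl_flatMap]
      · clear i1 i2 i3 i4 i5 i6
        induction front with
        | nil => simp
        | cons w l ih =>
          simp only [List.map_cons, List.sum_cons, List.length_cons]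
          omega
    · obtain ⟨g1, g2, g3, g4, g5⟩ := visit_foldl f (front.flatMap out) (f, []) (by simp)
        (by simp) (by simp)
      generalize (front.flatMap out).foldl visit (f, []) = q at *
      refine Ensures.step_bind (Ensures.pure (B := 0) ?_) le_rfl
      obtain ⟨f', front'⟩ := q
      simp only [List.length_flatMap, List.length_nil, zero_add] at g1 g2 g3 g4 g5
      have hreach : ∀ w, f' w = true → Relation.ReflTransGen E w₀ w := by
        intro w hw
        rcases (g5 w).1 hw with h | h
        · exact i5 w h
        · obtain ⟨v, hv, hvw⟩ := List.mem_flatMap.1 h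
          exact (i5 v (i3 v hv)).tail hvw
      have hclosed : ∀ w, f w = true → ∀ v ∈ out w, f' v = true := by
        intro w hw v hv
        by_cases hwf : w ∈ front
        · exact (g5 v).2 (Or.inr (List.mem_flatMap.2 ⟨w, hwf, hv⟩))
        · exact (g5 v).2 (Or.inl (i6 w hw hwf v hv))
      have hfw₀ : f' w₀ = true := (g5 _).2 (Or.inl i4)
      simp only [searchPotential, List.isEmpty_iff, List.isEmpty_eq_false_iff]
      refine ⟨fun hnil => ⟨fun w => ⟨hreach w, fun hw => ?_⟩, by omega⟩, fun hne => ⟨⟨hne, g1,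
        fun w hw => (g3 w).2 (Or.inr hw), hfw₀, hreach, fun w hw hwf v hv => ?_⟩, ?_, by omega⟩⟩
      · induction hw with
        | refl => exact hfw₀
        | tail _ hvw ih =>
          rw [g3, hnil] at ih
          exact hclosed _ (by simpa using ih) _ hvw
      · exact hclosed w (((g3 w).1 hw).resolve_right hwf) v hv
      · have hsum : (front'.map fun w => (out w).length).sum +
            ∑ w with f' w = false, (out w).length = ∑ w with f w = false, (out w).length := by
          rw [← List.sum_toFinset _ g1, ← Finset.sum_union]
          · refine Finset.sum_congr ?_ fun _ _ => rfl
            ext w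
            have h3 := g3 w
            have h4 := g4 w
            by_cases hwf : w ∈ front' <;> cases hf : f w <;> cases hf' : f' w <;> simp_all
          · rw [Finset.disjoint_left]
            intro w hw hw'
            have := (g3 w).2 (Or.inr (by simpa using hw))
            simp [this] at hw'
        have hpos : 0 < front'.length := List.length_pos_iff.2 hne
        omega
  · refine ⟨by simp, by simp, by simp, by simp, ?_, ?_⟩
    · intro w hw
      by_cases h : w = w₀
      · exact h ▸ .refl
      · simp [h] at hw
    · intro w hw hw'
      simp at hw'
      simp [hw'] at hw
  · have : (∑ w with Function.update (fun _ : W => false) w₀ true w = false, (out w).length) +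
        (out w₀).length ≤ ∑ w, (out w).length := by
      rw [← Finset.sum_filter_add_sum_filter_not Finset.univ
        (fun w => Function.update (fun _ : W => false) w₀ true w = false)]
      refine Nat.add_le_add_left ?_ _
      exact Finset.single_le_sum (f := fun w => (out w).length) (by simp) (by simp)
    simp only [searchPotential, List.length_singleton, List.map_cons, List.map_nil, List.sum_cons,
      List.sum_nil]
    omega

end Reachable

end Algorithm

/-! ### Results and costs of the parts of the algorithms -/

namespace Algorithm

open Comp MixedGraph

/-- The truth value of a proposition. -/
noncomputable def truth (p : Prop) : Bool := @decide p (Classical.propDecidable p)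

@[simp]
theorem truth_eq_true {p : Prop} : truth p = true ↔ p := by simp [truth]

@[simp]
theorem truth_eq_false {p : Prop} : truth p = false ↔ ¬ p := by simp [truth]

theorem eq_truth {b : Bool} {p : Prop} (h : b = true ↔ p) : b = truth p := by
  rw [Bool.eq_iff_iff, h, truth_eq_true]

theorem foldl_cons_filter {α β : Type} (c : α → Bool) (f : α → β) :
    ∀ (l : List α) (s : List β), l.foldl (fun s a => if c a = true then f a :: s else s) s =
      ((l.filter c).map f).reverse ++ s
  | [], _ => rfl
  | a :: l, s => by
    rw [List.foldl_cons, foldl_cons_filter c f l]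
    by_cases h : c a = true <;> simp [h]

theorem foldl_reverse_append {α β : Type} (g : α → List β) :
    ∀ (l : List α) (s : List β), l.foldl (fun s a => (g a).reverse ++ s) s =
      (l.flatMap g).reverse ++ s
  | [], _ => rfl
  | a :: l, s => by
    rw [List.foldl_cons, foldl_reverse_append g l]
    simp

theorem foldl_or {α : Type} (c : α → Bool) :
    ∀ (l : List α) (r : Bool), l.foldl (fun r a => r || c a) r = (r || l.any c)
  | [], r => by simp
  | a :: l, r => by rw [List.foldl_cons, foldl_or c l, List.any_cons, Bool.or_assoc]

theorem foldl_and {α : Type} (c : α → Bool) :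
    ∀ (l : List α) (r : Bool), l.foldl (fun r a => r && c a) r = (r && l.all c)
  | [], r => by simp
  | a :: l, r => by rw [List.foldl_cons, foldl_and c l, List.all_cons, Bool.and_assoc]

variable {V : Type} {G : MixedGraph V} {L : List (V × V × Mark)}

/-- The table of the marks of `G`. -/
def markTable (G : MixedGraph V) : Table (V × V) (Option Mark) := fun p => G.mark p.1 p.2

theorem ensures_testAdj (a b : V) :
    Ensures (testAdj (markTable G) a b) (· = truth (G.Adj a b)) 2 :=
  Ensures.step_bind (Ensures.step (eq_truth Iff.rfl)) le_rfl

theorem ensures_testParent (a b : V) :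
    Ensures (testParent (markTable G) a b) (· = truth (G.Directed a b)) 3 :=
  Ensures.step_bind (Ensures.step_bind (Ensures.step (eq_truth decide_eq_true_iff)) le_rfl) le_rfl

theorem ensures_testSpouse (a b : V) :
    Ensures (testSpouse (markTable G) a b) (· = truth (G.Bidirected a b)) 3 :=
  Ensures.step_bind (Ensures.step_bind (Ensures.step (eq_truth decide_eq_true_iff)) le_rfl) le_rfl

theorem ensures_listUnshielded (col : List (V × V × V)) :
    Ensures (listUnshielded (markTable G) col)
      (· = (col.filter fun τ => !truth (G.Adj τ.1 τ.2.2)).reverse) (4 * col.length) := by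
  refine (Ensures.forEach_const
    (fun T τ => if (!truth (G.Adj τ.1 τ.2.2)) = true then id τ :: T else T) 3 ?_ col []
    (by omega)).mono ?_ le_rfl
  · intro T τ
    refine (ensures_testAdj _ _).bind_eq (B₂ := 1) ?_ le_rfl
    by_cases h : G.Adj τ.1 τ.2.2
    · rw [if_pos (truth_eq_true.2 h)]
      exact Ensures.pure (by simp [h])
    · rw [if_neg (by simpa using h)]
      exact Ensures.step (by simp [h])
  · rintro _ rfl
    rw [foldl_cons_filter, List.map_id, List.append_nil]

theorem ensures_testAdjacencies (hL : G.ListedBy L) (H : MixedGraph V) :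
    Ensures (testAdjacencies L (markTable H)) (· = truth (∀ a b, G.Adj a b → H.Adj a b))
      (4 * L.length) := by
  refine (Ensures.forEach_const (fun r p => r && truth (H.Adj p.1 p.2.1)) 3
    ?_ L true (by omega : L.length * (3 + 1) ≤ 4 * L.length)).mono ?_ le_rfl
  · intro r p
    exact (ensures_testAdj p.1 p.2.1).bind_eq (B₂ := 1) (Ensures.step rfl) le_rfl
  rintro _ rfl
  refine eq_truth ?_
  simp only [foldl_and, Bool.true_and, List.all_eq_true, truth_eq_true, Prod.forall, hL.2]
  constructor
  · intro h a b hab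
    obtain ⟨m, hm⟩ := hab.exists_mark
    exact h a b m hm
  · intro h a b m hm
    exact h a b (by simp [Adj, hm])

variable [DecidableEq V]

theorem ensures_testCollider (a b c : V) :
    Ensures (testCollider (markTable G) a b c) (· = truth (G.Collider a b c)) 3 :=
  Ensures.step_bind (Ensures.step_bind (Ensures.step (eq_truth decide_eq_true_iff)) le_rfl) le_rfl

theorem ensures_testMem (τ : V × V × V) (T : List (V × V × V)) :
    Ensures (testMem τ T) (· = truth (τ ∈ T)) (2 * T.length) := by
  refine (Ensures.forEach_const (fun r τ' => r || decide (τ = τ')) 1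
    (fun r τ' => Ensures.step rfl) T false (by omega)).mono ?_ le_rfl
  rintro _ rfl
  exact eq_truth (by simp [foldl_or])

theorem ensures_testColliders (T : List (V × V × V)) :
    Ensures (testColliders T (markTable G)) (· = truth (∀ a b c, (a, b, c) ∈ T → G.Collider a b c))
      (5 * T.length) := by
  refine (Ensures.forEach_const (fun r τ => r && truth (G.Collider τ.1 τ.2.1 τ.2.2)) 4
    ?_ T true (by omega : T.length * (4 + 1) ≤ 5 * T.length)).mono ?_ le_rfl
  · intro r τ
    exact (ensures_testCollider τ.1 τ.2.1 τ.2.2).bind_eq (B₂ := 1) (Ensures.step rfl) le_rfl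
  rintro _ rfl
  exact eq_truth (by simp [foldl_and])

theorem ensures_load (hL : G.ListedBy L) :
    Ensures (load L) (· = markTable G) (2 * L.length + 1) := by
  refine Ensures.step_bind (B₁ := 2 * L.length) ?_ (by omega)
  refine (Ensures.forEach_const
    (fun g p => Function.update g (p.1, p.2.1) (some p.2.2)) 1 ?_ L _
    (by omega : L.length * (1 + 1) ≤ 2 * L.length)).mono ?_ le_rfl
  · intro g p
    exact Ensures.step rfl
  rintro _ rfl
  have key : ∀ (l : List (V × V × Mark)) (g : Table (V × V) (Option Mark)),
      (∀ p ∈ l, G.mark p.1 p.2.1 = some p.2.2) → ∀ a b,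
      (G.mark a b = g (a, b) ∨ ∃ m, (a, b, m) ∈ l) →
      l.foldl (fun g p => Function.update g (p.1, p.2.1) (some p.2.2)) g (a, b) = G.mark a b := by
    intro l
    induction l with
    | nil =>
      intro g _ a b h
      simpa using (h.resolve_right (by simp)).symm
    | cons p l ih =>
      intro g hl a b h
      refine ih _ (fun q hq => hl q (by simp [hq])) a b ?_
      by_cases hp : (a, b) = (p.1, p.2.1)
      · left
        obtain ⟨rfl, rfl⟩ := Prod.mk.inj hp
        simpa using hl p (by simp)
      · rcases h with h | ⟨m, hm⟩
        · left
          simpa only [Function.update_of_ne hp] using h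
        · right
          refine ⟨m, (List.mem_cons.1 hm).resolve_left ?_⟩
          rintro rfl
          exact hp rfl
  funext ⟨a, b⟩
  refine key L _ (fun p hp => (hL.2 _ _ _).1 hp) a b ?_
  cases hm : G.mark a b with
  | none => exact Or.inl rfl
  | some m => exact Or.inr ⟨m, (hL.2 _ _ _).2 hm⟩

theorem ensures_listColliders (hL : G.ListedBy L) :
    Ensures (listColliders L)
      (fun col => col.Nodup ∧ ∀ a b c, (a, b, c) ∈ col ↔ G.Collider a b c)
      (L.length * (3 * L.length + 1)) := by
  let c : V × V × Mark → V × V × Mark → Bool := fun p q =>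
    decide (p.2.1 = q.2.1 ∧ p.1 ≠ q.1 ∧ p.2.2 = Mark.arrow ∧ q.2.2 = Mark.arrow)
  let g : V × V × Mark → List (V × V × V) := fun p =>
    (L.filter (c p)).map fun q => (p.1, p.2.1, q.1)
  refine (Ensures.forEach_const (fun col p => (g p).reverse ++ col) (3 * L.length) ?_ L []
    le_rfl).mono ?_ le_rfl
  · intro col p
    refine (Ensures.forEach_const
      (fun col q => if c p q = true then (p.1, p.2.1, q.1) :: col else col) 2 ?_ L col
      (by omega)).mono ?_ le_rfl
    · intro col q
      refine Ensures.step_bind (B₁ := 1) ?_ le_rfl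
      by_cases h : c p q = true
      · simp only [h, if_true]
        rw [if_pos h]
        exact Ensures.step rfl
      · simp only [h]
        rw [if_neg h]
        exact Ensures.pure rfl
    · rintro _ rfl
      rw [foldl_cons_filter]
  · rintro _ rfl
    rw [foldl_reverse_append, List.append_nil, List.nodup_reverse]
    refine ⟨List.nodup_flatMap.2 ⟨fun p hp => ?_, ?_⟩, fun a b d => ?_⟩
    · refine List.Nodup.map_on ?_ (hL.1.filter _)
      rintro ⟨a, b, m⟩ h ⟨a', b', m'⟩ h' he
      simp only [List.mem_filter, c, decide_eq_true_eq] at h h'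
      simp only [Prod.mk.injEq, true_and] at he
      obtain ⟨-, h1, -, -, h2⟩ := h
      obtain ⟨-, h1', -, -, h2'⟩ := h'
      simp_all
    · refine hL.1.imp ?_
      rintro ⟨a, b, m⟩ ⟨a', b', m'⟩ hne
      rw [Function.onFun, List.disjoint_left]
      rintro _ h h'
      obtain ⟨q, hq, rfl⟩ := List.mem_map.1 h
      obtain ⟨q', hq', he⟩ := List.mem_map.1 h'
      simp only [List.mem_filter, c, decide_eq_true_eq] at hq hq'
      simp only [Prod.mk.injEq] at he
      exact hne (by rw [he.1, he.2.1, hq.2.2.2.1, hq'.2.2.2.1])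
    · simp only [List.mem_reverse, List.mem_flatMap, g, List.mem_map, List.mem_filter, c,
        decide_eq_true_eq, Prod.exists, Prod.mk.injEq]
      constructor
      · rintro ⟨a, b, m, h, d, b', m', ⟨h', rfl, hne, rfl, rfl⟩, rfl, rfl, rfl⟩
        exact ⟨hne, (hL.2 _ _ _).1 h, (hL.2 _ _ _).1 h'⟩
      · rintro ⟨hne, h1, h2⟩
        exact ⟨a, b, _, (hL.2 _ _ _).2 h1, d, b, _, ⟨(hL.2 _ _ _).2 h2, rfl, hne, rfl, rfl⟩,
          rfl, rfl, rfl⟩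

/-! ### The search for a discriminating walk -/

/-- The vertex set `𝕍` of the graph that is searched for the collider `⟨a, b, c⟩`. -/
def IsSearchVertex (G : MixedGraph V) (a b c : V) (k : V × V) : Prop :=
  (G.Directed k.1 c ∧ G.Directed k.2 c ∧ G.Bidirected k.1 k.2) ∨ k = (b, a)

/-- The edge set `𝔼` of the graph that is searched for the collider `⟨a, b, c⟩`. -/
def IsSearchEdge (G : MixedGraph V) (T : List (V × V × V)) (a b c : V) (k l : V × V) : Prop :=
  k.2 = l.1 ∧ (k.1, k.2, l.2) ∈ T ∧ IsSearchVertex G a b c k ∧ IsSearchVertex G a b c l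

/-- The search for the collider `⟨a, b, c⟩` succeeds. -/
def SearchSucceeds (G : MixedGraph V) (T : List (V × V × V)) (a b c : V) : Prop :=
  ∃ z y x, Relation.ReflTransGen (IsSearchEdge G T a b c) (b, a) (z, y) ∧ (z, y, x) ∈ T ∧
    ¬ G.Adj x c

theorem ensures_searchVertices (hL : G.ListedBy L) (a b c : V) :
    Ensures (searchVertices L (markTable G) a b c)
      (· = fun k => truth (IsSearchVertex G a b c k)) (11 * L.length + 2) := by
  let C : V → V → Prop := fun t u => G.Directed t c ∧ G.Directed u c ∧ G.Bidirected t u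
  let f : Table (V × V) Bool → V × V × Mark → Table (V × V) Bool := fun vs p =>
    if truth (C p.1 p.2.1) then Function.update vs (p.1, p.2.1) true else vs
  have key : ∀ (l : List (V × V × Mark)) (vs : Table (V × V) Bool) (k : V × V),
      l.foldl f vs k = true ↔ vs k = true ∨ ∃ m, (k.1, k.2, m) ∈ l ∧ C k.1 k.2 := by
    intro l
    induction l with
    | nil => simp
    | cons p l ih =>
      rintro vs ⟨t, u⟩
      obtain ⟨t', u', m'⟩ := p
      rw [List.foldl_cons, ih]
      simp only [f, truth_eq_true, List.mem_cons, Prod.mk.injEq]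
      by_cases hk : t = t' ∧ u = u'
      · obtain ⟨rfl, rfl⟩ := hk
        by_cases hC : C t u <;> simp [hC]
      · have : ((t, u) : V × V) ≠ (t', u') := by simpa using hk
        have hk' : ∀ m, ¬ (t = t' ∧ u = u' ∧ m = m') := fun m h => hk ⟨h.1, h.2.1⟩
        split_ifs
        · simp [Function.update_of_ne this, hk']
        · simp [hk']
  refine Ensures.step_bind (B₁ := 11 * L.length + 1) ?_ (by omega)
  refine Ensures.bind_eq (Ensures.forEach_const f 10 ?_ L _ (Nat.le_refl _))
    (Ensures.step ?_) (by omega)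
  · intro vs p
    refine (ensures_testParent _ _).bind_eq (B₂ := 7) ?_ le_rfl
    refine (ensures_testParent _ _).bind_eq (B₂ := 4) ?_ le_rfl
    refine (ensures_testSpouse _ _).bind_eq (B₂ := 1) ?_ le_rfl
    by_cases h : C p.1 p.2.1
    · rw [if_pos (by simpa [and_assoc] using h)]
      exact Ensures.step (by simp [f, h])
    · rw [if_neg (by simpa [C, and_assoc] using h)]
      exact Ensures.pure (by simp [f, h])
  · funext k
    refine eq_truth ?_
    by_cases hk : k = (b, a)
    · simp [hk, IsSearchVertex]
    · rw [Function.update_of_ne hk, key]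
      simp only [Bool.false_eq_true, false_or, IsSearchVertex, hk, or_false]
      constructor
      · rintro ⟨m, -, h⟩
        exact h
      · intro h
        exact ⟨_, (hL.2 _ _ _).2 h.2.2.1, h⟩

variable [Fintype V]

theorem ensures_searchEdges (T : List (V × V × V)) (a b c : V) :
    Ensures (searchEdges T fun k => truth (IsSearchVertex G a b c k))
      (fun out => (∀ k l, l ∈ out k ↔ IsSearchEdge G T a b c k l) ∧
        ∑ k, (out k).length ≤ T.length) (6 * T.length + 1) := by
  let C : V × V × V → Prop := fun τ =>
    IsSearchVertex G a b c (τ.1, τ.2.1) ∧ IsSearchVertex G a b c (τ.2.1, τ.2.2)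
  let f : Table (V × V) (List (V × V)) → V × V × V → Table (V × V) (List (V × V)) := fun out τ =>
    if truth (C τ) then
      Function.update out (τ.1, τ.2.1) ((τ.2.1, τ.2.2) :: out (τ.1, τ.2.1)) else out
  have key : ∀ (T : List (V × V × V)) (out : Table (V × V) (List (V × V))),
      (∀ k l, l ∈ T.foldl f out k ↔ l ∈ out k ∨ IsSearchEdge G T a b c k l) ∧
      ∑ k, (T.foldl f out k).length ≤ ∑ k, (out k).length + T.length := by
    intro T
    induction T with
    | nil => simp [IsSearchEdge]
    | cons τ T ih =>
      intro out
      obtain ⟨t, u, v⟩ := τ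
      rw [List.foldl_cons]
      obtain ⟨h1, h2⟩ := ih (f out (t, u, v))
      refine ⟨?_, h2.trans ?_⟩
      · rintro ⟨k₁, k₂⟩ ⟨l₁, l₂⟩
        rw [h1]
        simp only [f, IsSearchEdge, List.mem_cons, Prod.mk.injEq]
        by_cases hk : k₁ = t ∧ k₂ = u
        · obtain ⟨rfl, rfl⟩ := hk
          split_ifs with hC <;> rw [truth_eq_true] at hC
          · simp only [Function.update_self, List.mem_cons, Prod.mk.injEq, true_and]
            constructor
            · rintro ((⟨rfl, rfl⟩ | h) | h)
              · exact Or.inr ⟨rfl, Or.inl rfl, hC⟩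
              · exact Or.inl h
              · exact Or.inr ⟨h.1, Or.inr h.2.1, h.2.2⟩
            · rintro (h | ⟨rfl, rfl | h, h'⟩)
              · exact Or.inl (Or.inr h)
              · exact Or.inl (Or.inl ⟨rfl, rfl⟩)
              · exact Or.inr ⟨rfl, h, h'⟩
          · refine or_congr Iff.rfl (and_congr_right ?_)
            rintro rfl
            refine ⟨fun h => ⟨Or.inr h.1, h.2⟩, ?_⟩
            rintro ⟨⟨-, -, rfl⟩ | h, h'⟩
            · exact absurd h' hC
            · exact ⟨h, h'⟩
        · have hk' : ((k₁, k₂) : V × V) ≠ (t, u) := by simpa using hk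
          split_ifs
          · rw [Function.update_of_ne hk']
            tauto
          · tauto
      · simp only [f, truth_eq_true, List.length_cons]
        split_ifs
        · have h3 := Finset.sum_update_of_mem (Finset.mem_univ ((t, u) : V × V))
            (fun k => (out k).length) ((out (t, u)).length + 1)
          have h4 := Finset.sum_eq_add_sum_sdiff_singleton_of_mem
            (Finset.mem_univ ((t, u) : V × V)) fun k => (out k).length
          have h5 : ∀ k, (Function.update out (t, u) ((u, v) :: out (t, u)) k).length =
              Function.update (fun k => (out k).length) (t, u) ((out (t, u)).length + 1) k := by
            intro k
            by_cases hk : k = (t, u)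
            · simp [hk]
            · simp [hk]
          simp only [h5]
          omega
        · omega
  refine Ensures.step_bind (B₁ := 6 * T.length) ?_ (by omega)
  refine (Ensures.forEach_const f 5 ?_ T _ (by omega)).mono ?_ le_rfl
  · intro out τ
    refine Ensures.step_bind (B₁ := 4) ?_ le_rfl
    refine Ensures.step_bind (B₁ := 3) ?_ le_rfl
    by_cases h : C τ
    · rw [if_pos (by simpa using h)]
      exact Ensures.step_bind (Ensures.step_bind (Ensures.step (by simp [f, h])) le_rfl) le_rfl
    · rw [if_neg (by simpa [C] using h)]
      exact Ensures.pure (by simp [f, h])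
  · rintro _ rfl
    simpa using key T fun _ => []

theorem ensures_search (hL : G.ListedBy L) (T : List (V × V × V)) (a b c : V) :
    Ensures (search L (markTable G) T a b c) (· = truth (SearchSucceeds G T a b c))
      (11 * L.length + 21 * T.length + 10) := by
  refine (ensures_searchVertices hL a b c).bind_eq (B₂ := 21 * T.length + 8) ?_ (by omega)
  refine (ensures_searchEdges T a b c).bind (B₂ := 15 * T.length + 7) ?_ (by omega)
  rintro out ⟨hout, hsum⟩
  refine (ensures_reachable out (b, a)).bind (B₂ := 7 * T.length) ?_ (by omega)
  intro s hs
  replace hs : ∀ k, s k = true ↔ Relation.ReflTransGen (IsSearchEdge G T a b c) (b, a) k := by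
    intro k
    rw [hs]
    simp only [hout]
  refine Ensures.bind_eq (B₁ := 3 * T.length) (B₂ := 4 * T.length)
    (a := ((T.filter fun τ => s (τ.1, τ.2.1)).map fun τ => τ.2.2).reverse) ?_ ?_ (by omega)
  · refine (Ensures.forEach_const
      (fun xs τ => if s (τ.1, τ.2.1) = true then τ.2.2 :: xs else xs) 2 ?_ T []
      (by omega)).mono ?_ le_rfl
    · intro xs τ
      refine Ensures.step_bind (B₁ := 1) ?_ le_rfl
      by_cases h : s (τ.1, τ.2.1) = true
      · rw [if_pos h, if_pos h]
        exact Ensures.step rfl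
      · rw [if_neg h, if_neg h]
        exact Ensures.pure rfl
    · rintro _ rfl
      rw [foldl_cons_filter, List.append_nil]
  · refine (Ensures.forEach_const (fun r x => r || !truth (G.Adj x c)) 3
      ?_ _ false (B := 4 * T.length) ?_).mono ?_ le_rfl
    · intro r x
      exact (ensures_testAdj x c).bind_eq (B₂ := 1) (Ensures.step rfl) le_rfl
    · have := List.length_filter_le (fun τ : V × V × V => s (τ.1, τ.2.1)) T
      simp only [List.length_reverse, List.length_map]
      omega
    · rintro _ rfl
      refine eq_truth ?_
      simp only [foldl_or, Bool.false_or, List.any_eq_true, List.mem_reverse, List.mem_map,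
        List.mem_filter, Bool.not_eq_true', truth_eq_false, hs, Prod.exists, SearchSucceeds]
      constructor
      · rintro ⟨x, ⟨z, y, _, ⟨h1, h2⟩, rfl⟩, h3⟩
        exact ⟨z, y, _, h2, h1, h3⟩
      · rintro ⟨z, y, x, h1, h2, h3⟩
        exact ⟨x, ⟨z, y, x, ⟨h2, h1⟩, rfl⟩, h3⟩

end Algorithm

/-! ### The rounds of the algorithm `Triples` -/

namespace Algorithm

open Comp MixedGraph

variable {V : Type} {G : MixedGraph V} {L : List (V × V × Mark)}

/-- The colliders for which the algorithm `Triples` performs a search. -/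
def IsCandidate (G : MixedGraph V) (τ : V × V × V) : Prop :=
  G.Bidirected τ.1 τ.2.1 ∧ G.Directed τ.1 τ.2.2

/-- The triples that are added in a round that starts with the list `T`. -/
def IsAdded (G : MixedGraph V) (T : List (V × V × V)) (τ : V × V × V) : Prop :=
  IsCandidate G τ ∧ τ ∉ T ∧ SearchSucceeds G T τ.1 τ.2.1 τ.2.2

/-- The effect of a round, which starts with `T`, on its state for the collider `τ`. -/
noncomputable def roundStep (G : MixedGraph V) (T : List (V × V × V))
    (s : List (V × V × V) × Bool) (τ : V × V × V) : List (V × V × V) × Bool :=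
  if truth (IsAdded G T τ) = true then ((τ.2.2, τ.2.1, τ.1) :: τ :: s.1, false) else s

theorem ensures_round [DecidableEq V] [Fintype V] (hL : G.ListedBy L) (col T : List (V × V × V)) :
    Ensures (round L (markTable G) col T) (· = col.foldl (roundStep G T) (T, true))
      (7 * col.length + col.countP (fun τ => truth (IsCandidate G τ)) *
        (11 * L.length + 23 * T.length + 12)) := by
  refine (Ensures.forEach (roundStep G T) (fun τ => 6 +
    if truth (IsCandidate G τ) = true then 11 * L.length + 23 * T.length + 12 else 0)
    ?_ col (T, true)).mono (fun _ h => h) ?_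
  · intro s τ
    refine (ensures_testSpouse τ.1 τ.2.1).bind_eq (B₂ := 3 + if truth (IsCandidate G τ) = true then
      11 * L.length + 23 * T.length + 12 else 0) ?_ (by omega)
    refine (ensures_testParent τ.1 τ.2.2).bind_eq (B₂ := if truth (IsCandidate G τ) = true then
      11 * L.length + 23 * T.length + 12 else 0) ?_ le_rfl
    by_cases hc : IsCandidate G τ
    · rw [if_pos (by simpa [IsCandidate] using hc), if_pos (truth_eq_true.2 hc)]
      refine (ensures_testMem τ T).bind_eq (B₂ := 11 * L.length + 21 * T.length + 12) ?_ (by omega)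
      by_cases hm : τ ∈ T
      · rw [if_pos (truth_eq_true.2 hm)]
        exact Ensures.pure (by simp [roundStep, IsAdded, hm])
      · rw [if_neg (by simpa using hm)]
        refine (ensures_search hL T τ.1 τ.2.1 τ.2.2).bind_eq (B₂ := 2) ?_ (by omega)
        by_cases hs : SearchSucceeds G T τ.1 τ.2.1 τ.2.2
        · rw [if_pos (truth_eq_true.2 hs)]
          refine Ensures.step_bind (Ensures.step_bind (Ensures.pure (B := 0) ?_) le_rfl) le_rfl
          simp [roundStep, IsAdded, hc, hm, hs]
        · rw [if_neg (by simpa using hs)]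
          exact Ensures.pure (by simp [roundStep, IsAdded, hs])
    · rw [if_neg (by simpa [IsCandidate] using hc)]
      exact Ensures.pure (by simp [roundStep, IsAdded, hc])
  · induction col with
    | nil => simp
    | cons τ col ih =>
      rw [List.map_cons, List.sum_cons, List.length_cons, List.countP_cons]
      split_ifs with h
      · rw [add_mul]
        omega
      · rw [add_mul]
        omega

theorem roundStep_foldl (T : List (V × V × V)) :
    ∀ (col : List (V × V × V)) (s : List (V × V × V) × Bool),
      (∀ τ, τ ∈ (col.foldl (roundStep G T) s).1 ↔ τ ∈ s.1 ∨ ∃ σ ∈ col, IsAdded G T σ ∧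
        (τ = σ ∨ τ = (σ.2.2, σ.2.1, σ.1))) ∧
      (col.foldl (roundStep G T) s).1.length =
        s.1.length + 2 * col.countP (fun τ => truth (IsAdded G T τ)) ∧
      ((col.foldl (roundStep G T) s).2 = true ↔ s.2 = true ∧ ∀ σ ∈ col, ¬ IsAdded G T σ)
  | [], s => by simp
  | σ :: col, s => by
    rw [List.foldl_cons]
    obtain ⟨h1, h2, h3⟩ := roundStep_foldl T col (roundStep G T s σ)
    by_cases hσ : IsAdded G T σ
    · have hs : roundStep G T s σ = ((σ.2.2, σ.2.1, σ.1) :: σ :: s.1, false) :=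
        if_pos (truth_eq_true.2 hσ)
      refine ⟨fun τ => ?_, ?_, ?_⟩
      · rw [h1, hs]
        simp only [List.mem_cons, exists_eq_or_imp, hσ, true_and]
        have : ∀ p q r s : Prop, ((q ∨ p ∨ r) ∨ s ↔ r ∨ (p ∨ q) ∨ s) := by tauto
        exact this _ _ _ _
      · rw [h2, hs, List.countP_cons, if_pos (truth_eq_true.2 hσ)]
        simp only [List.length_cons]
        omega
      · rw [h3, hs]
        simp [hσ]
    · have hs : roundStep G T s σ = s := if_neg (by simpa using hσ)
      refine ⟨fun τ => ?_, ?_, ?_⟩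
      · rw [h1, hs]
        simp [hσ]
      · rw [h2, hs, List.countP_cons, if_neg (by simpa using hσ), Nat.add_zero]
      · rw [h3, hs]
        simp [hσ]

/-! ### Correctness of the searches -/

/-- A successful search finds a discriminating walk if it uses colliders with order only. -/
theorem SearchSucceeds.discWalk {T : List (V × V × V)} {a b c : V}
    (hT : ∀ a b c, (a, b, c) ∈ T → G.OrdCol a b c) (hac : G.Directed a c)
    (h : SearchSucceeds G T a b c) : G.DiscWalk c b a := by
  obtain ⟨z, y, x, hr, hT', hx⟩ := h
  have hpar : ∀ k, IsSearchVertex G a b c k → G.Directed k.2 c := by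
    rintro k (h | rfl)
    · exact h.2.1
    · exact hac
  have hy : IsSearchVertex G a b c (z, y) := by
    rcases Relation.ReflTransGen.cases_tail hr with h | ⟨k, -, h⟩
    · exact Or.inr h
    · exact h.2.2.2
  have hend : G.DiscWalk c z y := .base (hpar _ hy) (hT _ _ _ hT') hx
  have key : ∀ k, Relation.ReflTransGen (IsSearchEdge G T a b c) k (z, y) →
      G.DiscWalk c k.1 k.2 := by
    intro k hk
    induction hk using Relation.ReflTransGen.head_induction_on with
    | refl => exact hend
    | @head k l hkl _ ih =>
      obtain ⟨h1, h2, h3, h4⟩ := hkl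
      rw [← h1] at ih
      exact .step (hpar _ h3) (hT _ _ _ h2) ih
  exact key _ hr

/-- A list that contains the unshielded colliders and to which no triple is added contains all
colliders with order. -/
theorem mem_of_ordCol {T : List (V × V × V)}
    (hunsh : ∀ a b c, G.Collider a b c → ¬ G.Adj a c → (a, b, c) ∈ T)
    (hsymm : ∀ a b c, (a, b, c) ∈ T → (c, b, a) ∈ T)
    (hadd : ∀ a b c, G.Collider a b c → ¬ IsAdded G T (a, b, c)) {a b c : V}
    (h : G.OrdCol a b c) : (a, b, c) ∈ T := by
  refine OrdCol.rec (motive_1 := fun a b c _ => (a, b, c) ∈ T)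
    (motive_2 := fun c z y _ => ∀ a b, IsSearchVertex G a b c (z, y) →
      ∃ z' y' x, Relation.ReflTransGen (IsSearchEdge G T a b c) (z, y) (z', y') ∧
        (z', y', x) ∈ T ∧ ¬ G.Adj x c)
    (fun {a b c} hc hac => hunsh a b c hc hac) ?_ (fun _ ih => hsymm _ _ _ ih) ?_ ?_ h
  · intro a b c hc hd ih
    by_contra hn
    obtain ⟨u, hu⟩ := hd.exists_ordCol
    exact hadd a b c hc ⟨⟨⟨hc.2.1, hu.collider.2.1⟩, hd.directed⟩, hn, ih a b (Or.inr rfl)⟩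
  · intro c z y x _ _ hx ih a b _
    exact ⟨z, y, x, .refl, ih, hx⟩
  · intro c z y u hyc hT hd ih₁ ih₂ a b hv
    obtain ⟨v, hv'⟩ := hd.exists_ordCol
    have hu : IsSearchVertex G a b c (y, u) :=
      Or.inl ⟨hyc, hd.directed, hv'.collider.2.1, hT.collider.2.2⟩
    obtain ⟨z', y', x, hr, h1, h2⟩ := ih₂ a b hu
    exact ⟨z', y', x, hr.head ⟨rfl, ih₁, hv, hu⟩, h1, h2⟩

/-! ### The result and the number of steps of `Triples` -/

/-- A bound for the number of steps of a round of `Triples`, for a graph with `m` entries in its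
edge list, `k` colliders, and `K` colliders for which a search is performed. -/
def roundBound (m k K : ℕ) : ℕ := 7 * k + K * (11 * m + 69 * k + 12) + 1

/-- A bound for the number of steps of `Triples`. -/
def triplesBound (m k K : ℕ) : ℕ := 3 * m * m + 3 * m + 1 + 4 * k + (K + 1) * roundBound m k K

/-- The algorithm `Triples` lists the colliders with order. A round that is not the last adds a
candidate to the list, and candidates are added only once; this bounds the number of rounds and
the length of the list. -/
theorem ensures_triples [DecidableEq V] [Fintype V] (hL : G.ListedBy L) :
    ∃ col : List (V × V × V), col.Nodup ∧ (∀ a b c, (a, b, c) ∈ col ↔ G.Collider a b c) ∧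
      Ensures (triples L)
        (fun T => (∀ a b c, (a, b, c) ∈ T ↔ G.OrdCol a b c) ∧ T.length ≤ 3 * col.length)
        (triplesBound L.length col.length (col.countP fun τ => truth (IsCandidate G τ))) := by
  obtain ⟨col, t, ht, ⟨hnd, hcol⟩, htb⟩ := ensures_listColliders hL
  refine ⟨col, hnd, hcol, ?_⟩
  set m := L.length with hm
  set k := col.length with hk
  set K := col.countP fun τ => truth (IsCandidate G τ) with hK
  have hlist : Ensures (listColliders L) (· = col) (m * (3 * m + 1)) := ⟨col, t, ht, rfl, htb⟩
  let N : List (V × V × V) → ℕ := fun T =>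
    col.countP fun τ => truth (IsCandidate G τ ∧ τ ∉ T)
  have hNK : ∀ T, N T ≤ K := fun T => List.countP_mono_left fun τ _ h => by
    rw [truth_eq_true] at h ⊢
    exact h.1
  have hKk : K ≤ k := List.countP_le_length
  let I : List (V × V × V) → Prop := fun T =>
    (∀ a b c, (a, b, c) ∈ T → G.OrdCol a b c) ∧
    (∀ a b c, G.Collider a b c → ¬ G.Adj a c → (a, b, c) ∈ T) ∧
    (∀ a b c, (a, b, c) ∈ T → (c, b, a) ∈ T) ∧ T.length + 2 * N T ≤ 3 * k
  refine (ensures_load hL).bind_eq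
    (B₂ := m * (3 * m + 1) + 4 * k + (K + 1) * roundBound m k K) ?_ ?_
  rotate_left
  · rw [triplesBound, mul_add, ← mul_assoc, mul_comm m 3]
    omega
  refine hlist.bind_eq (B₂ := 4 * k + (K + 1) * roundBound m k K) ?_ (by omega)
  refine (ensures_listUnshielded col).bind_eq (B₂ := (K + 1) * roundBound m k K) ?_ le_rfl
  refine (Ensures.repeatUntil (I := I) (fun T => (N T + 1) * roundBound m k K)
    (fun _ => roundBound m k K) ?_ _ ?_).mono (fun T h => h)
    (Nat.mul_le_mul_right _ (Nat.succ_le_succ (hNK _)))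
  · rintro T ⟨i1, i2, i3, i4⟩
    refine (ensures_round hL col T).mono ?_ ?_
    · rintro _ rfl
      obtain ⟨h1, h2, h3⟩ := roundStep_foldl (G := G) T col (T, true)
      generalize col.foldl (roundStep G T) (T, true) = q at *
      obtain ⟨T', d⟩ := q
      simp only at h1 h2 h3
      have hpos : 0 < roundBound m k K := Nat.succ_pos _
      refine ⟨fun hd => ⟨?_, Nat.le_mul_of_pos_left _ (Nat.succ_pos _)⟩, fun hd => ?_⟩
      · have hadd := (h3.1 hd).2
        have h0 : col.countP (fun τ => truth (IsAdded G T τ)) = 0 := by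
          rw [List.countP_eq_zero]
          intro τ hτ
          simpa using hadd τ hτ
        have hTT' : ∀ τ, τ ∈ T' ↔ τ ∈ T := fun τ => by
          rw [h1]
          constructor
          · rintro (h | ⟨σ, hσ, hσ', -⟩)
            · exact h
            · exact absurd hσ' (hadd σ hσ)
          · exact Or.inl
        refine ⟨fun a b c => ?_, by simp only; omega⟩
        rw [hTT']
        exact ⟨i1 a b c, mem_of_ordCol i2 i3 fun a b c hc => hadd _ ((hcol a b c).2 hc)⟩
      · have hN : N T' + col.countP (fun τ => truth (IsAdded G T τ)) ≤ N T := by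
          have hsplit := List.countP_eq_countP_filter_add col
            (fun τ => truth (IsCandidate G τ ∧ τ ∉ T)) (fun τ => truth (IsAdded G T τ))
          rw [List.countP_filter, List.countP_filter] at hsplit
          refine le_of_le_of_eq ?_ hsplit.symm
          rw [add_comm]
          refine Nat.add_le_add (List.countP_mono_left fun τ _ h => ?_)
            (List.countP_mono_left fun τ hτ h => ?_)
          · rw [truth_eq_true] at h
            simp [h, h.1, h.2.1]
          · rw [truth_eq_true] at h
            have h4 := h.2
            rw [h1, not_or] at h4
            have h5 : ¬ IsAdded G T τ := fun h' => h4.2 ⟨τ, hτ, h', Or.inl rfl⟩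
            simp [h.1, h4.1, h5]
        have hne : 0 < col.countP (fun τ => truth (IsAdded G T τ)) := by
          rw [List.countP_pos_iff]
          by_contra hcon
          push Not at hcon
          have := h3.2 ⟨trivial, fun σ hσ h' => hcon σ hσ (truth_eq_true.2 h')⟩
          simp [this] at hd
        refine ⟨⟨fun a b c h => ?_, fun a b c hc hac => (h1 _).2 (Or.inl (i2 a b c hc hac)),
          fun a b c h => ?_, by simp only; omega⟩, ?_, hpos⟩
        · rcases (h1 _).1 h with h | ⟨⟨a', b', c'⟩, hσ, hσ', h⟩
          · exact i1 a b c h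
          · have hord : G.OrdCol a' b' c' := .discriminated ((hcol _ _ _).1 hσ)
              (hσ'.2.2.discWalk i1 hσ'.1.2)
            rcases h with h | h <;> obtain ⟨rfl, rfl, rfl⟩ := by simpa using h
            · exact hord
            · exact hord.symm
        · rw [h1] at h ⊢
          rcases h with h | ⟨σ, hσ, hσ', h⟩
          · exact Or.inl (i3 a b c h)
          · refine Or.inr ⟨σ, hσ, hσ', ?_⟩
            rcases h with rfl | h
            · exact Or.inr rfl
            · left
              obtain ⟨rfl, rfl, rfl⟩ := by simpa using h
              rfl
        · have : N T' + 1 ≤ N T := by omega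
          calc roundBound m k K + (N T' + 1) * roundBound m k K
              = (N T' + 1 + 1) * roundBound m k K := by ring
            _ ≤ (N T + 1) * roundBound m k K := Nat.mul_le_mul_right _ (by omega)
    · have hlen : 23 * T.length ≤ 69 * k := by omega
      have := Nat.mul_le_mul_left K
        (by omega : 11 * m + 23 * T.length + 12 ≤ 11 * m + 69 * k + 12)
      change 7 * k + K * (11 * m + 23 * T.length + 12) ≤ roundBound m k K
      rw [roundBound]
      omega
  · refine ⟨fun a b c h => ?_, fun a b c hc hac => ?_, fun a b c h => ?_, ?_⟩
    · simp only [List.mem_reverse, List.mem_filter, Bool.not_eq_true', truth_eq_false, hcol] at h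
      exact .unshielded h.1 h.2
    · simp only [List.mem_reverse, List.mem_filter, Bool.not_eq_true', truth_eq_false, hcol]
      exact ⟨hc, hac⟩
    · simp only [List.mem_reverse, List.mem_filter, Bool.not_eq_true', truth_eq_false, hcol] at h ⊢
      exact ⟨h.1.symm, fun h' => h.2 h'.symm⟩
    · have h1 := List.length_filter_le (fun τ : V × V × V => !truth (G.Adj τ.1 τ.2.2)) col
      have h2 := hNK ((col.filter fun τ => !truth (G.Adj τ.1 τ.2.2)).reverse)
      simp only [List.length_reverse]
      omega

end Algorithm

/-! ### Counting edges, colliders and triangles -/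

namespace Algorithm

open Comp MixedGraph

variable {V : Type} {G : MixedGraph V} {L : List (V × V × Mark)}

/-- A set `E` of pairs spans at most `|E| ^ (3 / 2)` triangles. By the Cauchy–Schwarz inequality it
suffices to count the pairs of triangles with a common first edge, and such a pair is determined by
one edge from each triangle. -/
theorem card_triangles_sq_le [DecidableEq V] (S : Finset (V × V × V)) (E : Finset (V × V))
    (hS : ∀ τ ∈ S, (τ.1, τ.2.1) ∈ E ∧ (τ.1, τ.2.2) ∈ E ∧ (τ.2.2, τ.2.1) ∈ E) :
    S.card ^ 2 ≤ E.card ^ 3 := by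
  let F : V × V → Finset (V × V × V) := fun p => S.filter fun τ => (τ.1, τ.2.1) = p
  have h1 : S.card = ∑ p ∈ E, (F p).card :=
    Finset.card_eq_sum_card_fiberwise fun τ hτ => (hS τ hτ).1
  have h2 : ∑ p ∈ E, (F p).card ^ 2 ≤ E.card * E.card := by
    have h3 : ∑ p ∈ E, (F p).card ^ 2 = (E.sigma fun p => F p ×ˢ F p).card := by
      rw [Finset.card_sigma]
      simp only [Finset.card_product, sq]
    rw [h3, ← Finset.card_product]
    refine Finset.card_le_card_of_injOn
      (fun q => ((q.2.1.1, q.2.1.2.2), (q.2.2.2.2, q.2.2.2.1))) ?_ ?_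
    · rintro ⟨p, τ, τ'⟩ hq
      simp only [Finset.coe_sigma, Set.mem_sigma_iff, Finset.mem_coe, Finset.mem_product, F,
        Finset.mem_filter] at hq ⊢
      exact ⟨(hS τ hq.2.1.1).2.1, (hS τ' hq.2.2.1).2.2⟩
    · rintro ⟨⟨a, b⟩, ⟨a₁, b₁, c₁⟩, ⟨a₂, b₂, c₂⟩⟩ hq
        ⟨⟨a', b'⟩, ⟨a₁', b₁', c₁'⟩, ⟨a₂', b₂', c₂'⟩⟩ hq' he
      simp only [Finset.coe_sigma, Set.mem_sigma_iff, Finset.mem_coe, Finset.mem_product, F,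
        Finset.mem_filter, Prod.mk.injEq] at hq hq' he
      obtain ⟨-, ⟨-, rfl, rfl⟩, -, rfl, rfl⟩ := hq
      obtain ⟨-, ⟨-, rfl, rfl⟩, -, rfl, rfl⟩ := hq'
      obtain ⟨⟨rfl, rfl⟩, rfl, rfl⟩ := he
      rfl
  calc S.card ^ 2 = (∑ p ∈ E, (F p).card) ^ 2 := by rw [h1]
    _ ≤ E.card * ∑ p ∈ E, (F p).card ^ 2 := sq_sum_le_card_mul_sum_sq
    _ ≤ E.card * (E.card * E.card) := Nat.mul_le_mul_left _ h2
    _ = E.card ^ 3 := by ring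

theorem exists_edge_finset [DecidableEq V] (hL : G.ListedBy L) :
    ∃ E : Finset (V × V), E.card = L.length ∧ ∀ a b, (a, b) ∈ E ↔ G.Adj a b := by
  refine ⟨(L.map fun p => (p.1, p.2.1)).toFinset, ?_, fun a b => ?_⟩
  · rw [List.toFinset_card_of_nodup, List.length_map]
    refine List.Nodup.map_on ?_ hL.1
    rintro ⟨a, b, m⟩ h ⟨a', b', m'⟩ h' he
    obtain ⟨rfl, rfl⟩ := Prod.mk.inj he
    have := ((hL.2 _ _ _).1 h).symm.trans ((hL.2 _ _ _).1 h')
    rw [Option.some.inj this]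
  · simp only [List.mem_toFinset, List.mem_map, Prod.exists, Prod.mk.injEq, hL.2]
    constructor
    · rintro ⟨a, b, m, h, rfl, rfl⟩
      simp [Adj, h]
    · intro h
      obtain ⟨m, hm⟩ := h.exists_mark
      exact ⟨a, b, m, hm, rfl, rfl⟩

theorem length_eq_two_mul_numEdges [Fintype V] [DecidableEq V] (hL : G.ListedBy L) :
    L.length = 2 * G.numEdges := by
  classical
  obtain ⟨E, hE, hmem⟩ := exists_edge_finset hL
  have h1 : G.numEdges = G.skeleton.edgeFinset.card := by
    rw [numEdges, ← SimpleGraph.coe_edgeFinset, Set.ncard_coe_finset]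
  rw [h1, ← SimpleGraph.dart_card_eq_twice_card_edges, ← hE, ← Finset.card_univ,
    ← Finset.card_image_of_injective _ SimpleGraph.Dart.toProd_injective]
  congr 1
  ext ⟨a, b⟩
  rw [hmem, Finset.mem_image]
  constructor
  · intro h
    exact ⟨⟨(a, b), h⟩, Finset.mem_univ _, rfl⟩
  · rintro ⟨⟨⟨a', b'⟩, h⟩, -, he⟩
    obtain ⟨rfl, rfl⟩ := Prod.mk.inj he
    exact h

theorem triplesBound_le {e n k K : ℕ} (hn : 0 < e → 0 < n) (hk : k ≤ 2 * e * n)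
    (hK : K ^ 2 ≤ (2 * e) ^ 3) : triplesBound (2 * e) k K ≤ 3400 * (n * e ^ 4) + 2 := by
  rcases Nat.eq_zero_or_pos e with rfl | he
  · obtain rfl : k = 0 := by simpa using hk
    obtain rfl : K = 0 := by simpa using hK
    simp [triplesBound, roundBound]
  have hn := hn he
  have hpow : ∀ i ≤ 4, e ^ i ≤ n * e ^ 4 := fun i hi =>
    (Nat.pow_le_pow_right he hi).trans (Nat.le_mul_of_pos_left _ hn)
  have h1 := hpow 1 (by omega)
  have h2 := hpow 2 (by omega)
  have h3 := hpow 3 (by omega)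
  have h4 := hpow 4 le_rfl
  have hen : e * n ≤ n * e ^ 4 := by
    rw [mul_comm]
    exact Nat.mul_le_mul_left n (Nat.le_self_pow (by omega) _)
  have hK' : (K + 1) * (K + 1) ≤ 18 * e ^ 3 := by
    have : 1 ≤ e ^ 3 := Nat.one_le_pow _ _ he
    nlinarith [sq_nonneg ((K : ℤ) - 1), show (2 * e) ^ 3 = 8 * e ^ 3 by ring,
      show 2 * K ≤ K ^ 2 + 1 by nlinarith [two_mul_le_add_sq K 1]]
  have hround : roundBound (2 * e) k K ≤ (K + 1) * (152 * (e * n) + 22 * e + 13) := by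
    simp only [roundBound]
    have h5 : 7 * k + 1 ≤ 152 * (e * n) + 22 * e + 13 := by
      rw [mul_assoc] at hk
      omega
    have h6 : K * (11 * (2 * e) + 69 * k + 12) ≤ K * (152 * (e * n) + 22 * e + 13) := by
      rw [mul_assoc] at hk
      exact Nat.mul_le_mul_left K (by omega)
    rw [add_mul, one_mul]
    omega
  have hmain : (K + 1) * roundBound (2 * e) k K ≤ 3366 * (n * e ^ 4) := by
    calc (K + 1) * roundBound (2 * e) k K
        ≤ (K + 1) * ((K + 1) * (152 * (e * n) + 22 * e + 13)) := Nat.mul_le_mul_left _ hround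
      _ = (K + 1) * (K + 1) * (152 * (e * n) + 22 * e + 13) := by ring
      _ ≤ 18 * e ^ 3 * (152 * (e * n) + 22 * e + 13) := Nat.mul_le_mul_right _ hK'
      _ = 18 * (152 * (n * e ^ 4) + 22 * e ^ 4 + 13 * e ^ 3) := by ring
      _ ≤ 3366 * (n * e ^ 4) := by omega
  have hsq : 3 * (2 * e) * (2 * e) = 12 * e ^ 2 := by ring
  rw [mul_assoc] at hk
  rw [pow_one] at h1
  rw [triplesBound]
  omega

/-! ### The algorithms are correct and run in time `O(n e⁴)` -/

variable [Fintype V] [DecidableEq V]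

theorem length_le (hL : G.ListedBy L) : L.length ≤ 2 * (Fintype.card V * G.numEdges ^ 4) := by
  rw [length_eq_two_mul_numEdges hL]
  refine Nat.mul_le_mul_left 2 ?_
  rcases Nat.eq_zero_or_pos G.numEdges with h | h
  · rw [h]
    exact Nat.zero_le _
  · have hV : 0 < Fintype.card V := by
      rw [Fintype.card_pos_iff]
      by_contra hV
      rw [not_nonempty_iff] at hV
      have := length_eq_two_mul_numEdges hL
      rw [List.eq_nil_iff_forall_not_mem.2 fun p (_ : p ∈ L) => hV.elim p.1] at this
      simp at this
      omega
    exact (Nat.le_self_pow (by omega) _).trans (Nat.le_mul_of_pos_left _ hV)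

theorem ensures_triples_le (hL : G.ListedBy L) :
    Ensures (triples L) (fun T => (∀ a b c, (a, b, c) ∈ T ↔ G.OrdCol a b c) ∧
      T.length ≤ 6 * (Fintype.card V * G.numEdges ^ 4))
      (3400 * (Fintype.card V * G.numEdges ^ 4) + 2) := by
  obtain ⟨col, hnd, hcol, h⟩ := ensures_triples hL
  obtain ⟨E, hE, hmem⟩ := exists_edge_finset hL
  have hlen := length_eq_two_mul_numEdges hL
  set e := G.numEdges
  set n := Fintype.card V
  have hk : col.length ≤ 2 * e * n := by
    rw [← hlen, ← hE, ← List.toFinset_card_of_nodup hnd]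
    have hn : n = (Finset.univ : Finset V).card := rfl
    rw [hn, ← Finset.card_product]
    refine Finset.card_le_card_of_injOn (fun τ => ((τ.1, τ.2.1), τ.2.2)) ?_ ?_
    · rintro ⟨a, b, c⟩ hτ
      have := (hcol a b c).1 (by simpa using hτ)
      simpa [hmem] using this.2.1.adj
    · rintro ⟨a, b, c⟩ - ⟨a', b', c'⟩ - he
      simp only [Prod.mk.injEq] at he
      simp [he]
  have hn : 0 < e → 0 < n := by
    intro he
    by_contra hn
    have := length_le hL
    rw [hlen, show Fintype.card V = 0 by omega] at this
    omega
  have hK : (col.countP fun τ => truth (IsCandidate G τ)) ^ 2 ≤ (2 * e) ^ 3 := by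
    rw [← hlen, ← hE, List.countP_eq_length_filter,
      ← List.toFinset_card_of_nodup (hnd.filter _)]
    refine card_triangles_sq_le _ E ?_
    rintro ⟨a, b, c⟩ hτ
    simp only [List.mem_toFinset, List.mem_filter, hcol, truth_eq_true] at hτ
    simp only [hmem]
    exact ⟨hτ.1.2.1.adj, hτ.2.2.adj, hτ.1.2.2.adj⟩
  refine h.mono (fun T hT => ⟨hT.1, hT.2.trans ?_⟩) (hlen ▸ triplesBound_le hn hk hK)
  rcases Nat.eq_zero_or_pos e with he | he
  · rw [he] at hk
    omega
  · have : e * n ≤ n * e ^ 4 := by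
      rw [mul_comm]
      exact Nat.mul_le_mul_left n (Nat.le_self_pow (by omega) _)
    rw [mul_assoc] at hk
    omega

theorem ensures_equivalent {G₁ G₂ : MixedGraph V} {L₁ L₂ : List (V × V × Mark)} {X : ℕ}
    (h₁ : G₁.ListedBy L₁) (h₂ : G₂.ListedBy L₂) (hX₁ : Fintype.card V * G₁.numEdges ^ 4 ≤ X)
    (hX₂ : Fintype.card V * G₂.numEdges ^ 4 ≤ X) :
    Ensures (equivalent L₁ L₂) (fun r => r = true ↔ Agree G₁ G₂) (7000 * X + 6) := by
  have l₁ := length_le h₁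
  have l₂ := length_le h₂
  refine (ensures_load h₁).bind_eq (B₂ := 6996 * X + 5) ?_ (by omega)
  refine (ensures_load h₂).bind_eq (B₂ := 6992 * X + 4) ?_ (by omega)
  refine (ensures_testAdjacencies h₁ G₂).bind_eq (B₂ := 6984 * X + 4) ?_ (by omega)
  refine (ensures_testAdjacencies h₂ G₁).bind_eq (B₂ := 6976 * X + 4) ?_ (by omega)
  by_cases hadj : (∀ a b, G₁.Adj a b → G₂.Adj a b) ∧ ∀ a b, G₂.Adj a b → G₁.Adj a b
  swap
  · rw [if_neg (by rwa [Bool.and_eq_true, truth_eq_true, truth_eq_true])]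
    have hno : ¬ Agree G₁ G₂ := fun h =>
      hadj ⟨fun a b => (h.adj_iff a b).1, fun a b => (h.adj_iff a b).2⟩
    exact Ensures.pure (by simpa using hno)
  rw [if_pos (by rwa [Bool.and_eq_true, truth_eq_true, truth_eq_true])]
  refine (ensures_triples_le h₁).bind (B₂ := 3576 * X + 2) ?_ (by omega)
  rintro T₁ ⟨hT₁, hl₁⟩
  refine (ensures_testColliders T₁).bind_eq (B₂ := 3546 * X + 2) ?_ (by omega)
  by_cases hc₁ : ∀ a b c, (a, b, c) ∈ T₁ → G₂.Collider a b c
  swap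
  · rw [if_neg (by simpa using hc₁)]
    have hno : ¬ Agree G₁ G₂ := fun h => hc₁ fun a b c hT => h.left a b c ((hT₁ a b c).1 hT)
    exact Ensures.pure (by simpa using hno)
  rw [if_pos (truth_eq_true.2 hc₁)]
  refine (ensures_triples_le h₂).bind (B₂ := 146 * X) ?_ (by omega)
  rintro T₂ ⟨hT₂, hl₂⟩
  refine (ensures_testColliders T₂).bind_eq (B₂ := 0) ?_ (by omega)
  by_cases hc₂ : ∀ a b c, (a, b, c) ∈ T₂ → G₁.Collider a b c
  · rw [if_pos (truth_eq_true.2 hc₂)]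
    have hyes : Agree G₁ G₂ := ⟨fun a b => ⟨hadj.1 a b, hadj.2 a b⟩,
      fun a b c h => hc₁ a b c ((hT₁ a b c).2 h), fun a b c h => hc₂ a b c ((hT₂ a b c).2 h)⟩
    exact Ensures.pure (by simpa using hyes)
  · rw [if_neg (by simpa using hc₂)]
    have hno : ¬ Agree G₁ G₂ := fun h => hc₂ fun a b c hT => h.right a b c ((hT₂ a b c).1 hT)
    exact Ensures.pure (by simpa using hno)

end Algorithm

theorem propositionA2 :
    ∃ C : ℕ,
      (∀ (V : Type) [Fintype V] [DecidableEq V] (G : MixedGraph V) (L : List (V × V × Mark)),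
        G.IsMAG → G.ListedBy L →
        ∃ (T : List (V × V × V)) (t : ℕ),
          (Algorithm.triples L).HaltsWith T t ∧
          G.orderedColliders ⊆ {τ | τ ∈ T} ∧
          {τ | τ ∈ T} ⊆ G.invariantColliders ∧
          t ≤ C * (Fintype.card V * G.numEdges ^ 4 + 1)) ∧
      (∀ (V : Type) [Fintype V] [DecidableEq V] (G₁ G₂ : MixedGraph V)
          (L₁ L₂ : List (V × V × Mark)),
        G₁.IsMAG → G₂.IsMAG → G₁.ListedBy L₁ → G₂.ListedBy L₂ →
        ∃ (r : Bool) (t : ℕ),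
          (Algorithm.equivalent L₁ L₂).HaltsWith r t ∧
          (r = true ↔ MixedGraph.MarkovEquiv G₁ G₂) ∧
          t ≤ C * (Fintype.card V * (max G₁.numEdges G₂.numEdges) ^ 4 + 1)) := by
  refine ⟨7000, fun V _ _ G L hG hL => ?_, fun V _ _ G₁ G₂ L₁ L₂ hG₁ hG₂ hL₁ hL₂ => ?_⟩
  · obtain ⟨T, t, ht, ⟨hT, -⟩, htb⟩ := Algorithm.ensures_triples_le hL
    refine ⟨T, t, ht, ?_, ?_, by omega⟩
    · rintro ⟨a, b, c⟩ h
      exact (hT a b c).2 (MixedGraph.ordCol_of_mem_orderedColliders h)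
    · rintro ⟨a, b, c⟩ h
      exact ((hT a b c).1 h).mem_invariantColliders hG
  · obtain ⟨r, t, ht, hr, htb⟩ := Algorithm.ensures_equivalent hL₁ hL₂
      (Nat.mul_le_mul_left (Fintype.card V) (Nat.pow_le_pow_left (le_max_left _ G₂.numEdges) 4))
      (Nat.mul_le_mul_left (Fintype.card V) (Nat.pow_le_pow_left (le_max_right G₁.numEdges _) 4))
    exact ⟨r, t, ht, hr.trans (MixedGraph.markovEquiv_iff_agree hG₁ hG₂).symm, by omega⟩
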